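/- **Setting.** Two agents with budgets $B_1,B_2>0$ and per-item values $v_1,v_2$ take part in $k$ first-price sealed-bid auctions of identical items, held one after the other. A bid is $b$ or $b+$ ($b+$ beats $b$, loses to every $b'>b$, and pays $b$); the higher bid wins and is deducted from the winner's budget, equal bids are resolved by a fair coin. An agent's utility is $v_i$ times the number of her items plus her remaining budget. Assume $v_i>2^kB_i$ for $i=1,2$. Write $-i$ for the opponent of $i$. The *canonical outcome* and its expected utility $U^{(k)}_i(B_i,B_{-i})$ are defined recursively. Put $U^{(0)}_i(B_i,B_{-i})=B_i$. For $k\ge1$ let $$W_i(p)=v_i+U^{(k-1)}_i(B_i-p,B_{-i}),\qquad L_i(p)=U^{(k-1)}_i(B_i,\max(B_{-i}-p,0)),$$ and let the critical price be $p_i=\sup\{p\in[0,B_i]: W_i(p)>L_i(p)\}$ (so agent $i$ prefers winning below $p_i$ and losing at affordable prices above $p_i$). If $p_i>p_{-i}$, agent $i$ bids $p_{-i}+$ and agent $-i$ bids $p_{-i}$ in the first round; if $p_i=p_{-i}$, both bid $p_i$. Then the canonical outcome for $k-1$ items with the remaining budgets is followed. For integers $m,n$ with $m+n+1\ge0$ let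 $\phi(m,n)$ be the probability of at least $n+1$ heads in $m+n+1$ tosses of a fair coin (so $\phi(-1,n)=0$). **Proposition.** Let $i\in\{1,2\}$. 1. $U^{(k)}_i$, as a function of both budgets (with $v_1,v_2$ fixed), is jointly continuous at $(B_i,B_{-i})$ if and only if there are no integers $k_i,k_{-i}\ge0$ with $k_i+k_{-i}=k$ and $\frac{B_i}{B_{-i}}=\frac{k_i}{k_{-i}+1}$. 2. If $\frac{B_i}{B_{-i}}=\frac{k_i}{k_{-i}+1}$ with integers $k_i,k_{-i}\ge0$, $k_i+k_{-i}=k$, then, with $B_i$ fixed in the first two limits and $B_{-i}$ fixed in the last two, $$\lim_{b\to(\frac{k_{-i}+1}{k_i}B_i)^-}U^{(k)}_i(B_i,b)=k_iv_i,\qquad \lim_{b\to(\frac{k_{-i}+1}{k_i}B_i)^+}U^{(k)}_i(B_i,b)=(k_i-1)v_i+B_i,$$ $$\lim_{b\to(\frac{k_i}{k_{-i}+1}B_{-i})^-}U^{(k)}_i(b,B_{-i})=(k_i-1)v_i+\tfrac{k_i}{k_{-i}+1}B_{-i},\qquad \lim_{b\to(\frac{k_i}{k_{-i}+1}B_{-i})^+}U^{(k)}_i(b,B_{-i})=k_iv_i,$$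 and at the jump itself $$U^{(k)}_i(B_i,B_{-i})=(k_i-1)v_i+\phi(k_{-i},k_i-1)\,v_i+\phi(k_i-1,k_{-i})\,B_i-\phi(k_i-2,k_{-i}+1)\,B_{-i}.$$ -/

import Mathlib

open Filter Topology

namespace SeqAuction

/-- A sealed bid: `⟨b, false⟩` is the bid `b`, and `⟨b, true⟩` is the bid `b+`, infinitesimally
larger than `b` and charged `b` when it wins. -/
structure Bid where
  amount : ℝ
  plus : Bool

/-- The order on bids: `b+` beats `b`, and both are beaten by every larger amount. -/
def Bid.Beats (b c : Bid) : Prop :=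
  c.amount < b.amount ∨ (c.amount = b.amount ∧ b.plus = true ∧ c.plus = false)

open Classical in
/-- Expected payoff of an agent in one first-price round: the higher bid wins and pays its own
amount, equal bids are resolved by a fair coin. `win p` (`lose p`) is the payoff of the agent if
she (her opponent) wins the item at price `p`. -/
noncomputable def roundPayoff (own other : Bid) (win lose : ℝ → ℝ) : ℝ :=
  if own.Beats other then win own.amount
  else if other.Beats own then lose other.amount
  else (win own.amount + lose other.amount) / 2

/-! The two agents are the elements of `Bool`; the opponent of `i` is `!i`, and `v i` is the value
of an item for `i`. In `f i x y` the number `x` is the budget of agent `i` and `y` the budget of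
agent `!i`. The argument `U` is the expected utility of the continuation, in which one item less is
sold. -/

/-- Utility of agent `i` if she wins the current item at price `p`. -/
noncomputable def winningUtility (v : Bool → ℝ) (U : Bool → ℝ → ℝ → ℝ) (i : Bool) (x y p : ℝ) : ℝ :=
  v i + U i (x - p) y

/-- Utility of agent `i` if her opponent wins the current item at price `p`. A price above the
opponent's budget `y` leaves the opponent without any money. -/
noncomputable def losingUtility (U : Bool → ℝ → ℝ → ℝ) (i : Bool) (x y p : ℝ) : ℝ :=
  U i x (max (y - p) 0)

/-- The critical price of agent `i`: among the prices that she can pay, she strictly prefers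
winning below it and losing above it. It is her whole budget `x` if she prefers winning at every
price up to `x`. -/
noncomputable def criticalPrice (v : Bool → ℝ) (U : Bool → ℝ → ℝ → ℝ) (i : Bool) (x y : ℝ) : ℝ :=
  sSup {p : ℝ | 0 ≤ p ∧ p ≤ x ∧ losingUtility U i x y p < winningUtility v U i x y p}

/-- The supremum is the price with the defining property of a critical price. -/
theorem criticalPrice_eq (v : Bool → ℝ) (U : Bool → ℝ → ℝ → ℝ) (i : Bool) (x y c : ℝ)
    (hv : 0 < v i) (hy : 0 ≤ y) (hc0 : 0 ≤ c) (hcx : c ≤ x)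
    (hlow : ∀ p, 0 ≤ p → p < c → losingUtility U i x y p < winningUtility v U i x y p)
    (hhigh : ∀ p, c < p → p ≤ x → winningUtility v U i x y p < losingUtility U i x y p) :
    criticalPrice v U i x y = c := by
  have h0 : losingUtility U i x y 0 < winningUtility v U i x y 0 := by
    simp [losingUtility, winningUtility, max_eq_left hy, hv]
  unfold criticalPrice
  apply csSup_eq_of_forall_le_of_forall_lt_exists_gt
  · exact ⟨0, le_refl _, hc0.trans hcx, h0⟩
  · rintro p ⟨-, hpx, hp⟩
    by_contra! hcp
    exact lt_asymm hp (hhigh p hcp hpx)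
  · intro w hw
    rcases hc0.eq_or_lt with h | h
    · exact ⟨0, ⟨le_refl _, hc0.trans hcx, h0⟩, by rw [h]; exact hw⟩
    · obtain ⟨q, hq1, hq2⟩ := exists_between (max_lt hw h)
      have hq0 : 0 ≤ q := (le_max_right w 0).trans hq1.le
      exact ⟨q, ⟨hq0, hq2.le.trans hcx, hlow q hq0 hq2⟩, (le_max_left w 0).trans_lt hq1⟩

open Classical in
/-- First-round bid of agent `i` in the canonical outcome: both agents bid the smaller of the two
critical prices, and an agent whose critical price is strictly larger adds a `+`. -/
noncomputable def canonicalBid (v : Bool → ℝ) (U : Bool → ℝ → ℝ → ℝ) (i : Bool) (x y : ℝ) : Bid where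
  amount := min (criticalPrice v U i x y) (criticalPrice v U (!i) y x)
  plus := decide (criticalPrice v U (!i) y x < criticalPrice v U i x y)

/-- `utility v k i x y` is the expected utility of agent `i` (value of the items that she gets plus
her remaining budget) in the canonical outcome of the sequential auction of `k` items, when her
budget is `x` and the budget of her opponent is `y`. -/
noncomputable def utility (v : Bool → ℝ) : ℕ → Bool → ℝ → ℝ → ℝ
  | 0 => fun _ x _ => x
  | k + 1 => fun i x y =>
      roundPayoff (canonicalBid v (utility v k) i x y) (canonicalBid v (utility v k) (!i) y x)
        (winningUtility v (utility v k) i x y) (losingUtility (utility v k) i x y)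

/-- Probability of at least `n + 1` heads in `m + n + 1` independent tosses of a fair coin, for
integers `m`, `n` with `m + n + 1 ≥ 0`. -/
noncomputable def coinPhi (m n : ℤ) : ℝ :=
  ((Finset.univ.filter fun s : Fin (m + n + 1).toNat → Bool =>
      n + 1 ≤ ((Finset.univ.filter fun j => s j = true).card : ℤ)).card : ℝ) /
    2 ^ (m + n + 1).toNat

end SeqAuction

/-! Cut the quadrant of budgets into cells: cell $(m,n)$, $m+n=k$, is given by $my<(n+1)x$ and
$nx<(m+1)y$. Neighbouring cells are separated by a ray $(m+1)y=(n+1)x$, called a wall below; the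
walls are the jumps. Inside cell $(m,n)$ the utility is $mv_i$ plus a continuous `leftover m n`,
which is $0$ on the lower wall of the cell and $x$ on the upper one (`leftover_lower`,
`leftover_upper`). Continuity off the walls and all one-sided limits follow. The cell formula,
together with bounds on the walls, is proved by induction on $k$ (`utilityShape`).

The leftover is built without reference to the auction. Call the agent with budget $x$ poorer if
$(n+1)x\le(m+1)y$. Her leftover is `reserve m n x y`, and the opponent's $n$ items cost the opponent
$n$ times that amount in all. The recursion expresses that the poorer agent wins the first item at
the richer agent's critical price. This is either the price of indifference for the richer agent
(`balancePrice`: both $y-p-nB$ and $y-(n+1)A$ are her final money) or, if larger, the price at which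
a win puts the budgets on a wall, because a cheaper win brings her one more item. The decisive
inequality is `reserve_lose_le`: at this price the poorer agent does not prefer losing, so her
critical price is at least as high. If the two critical prices coincide, both results of the coin
give the same utilities. This is `UtilityShape.utility_succ_of_poor`.

Prices that lead out of the cells concerned need only crude bounds: utility climbs a staircase with
steps of height about $v_i$ (`UtilityShape.lt_utility`, `UtilityShape.utility_le`). On a wall the
coin may average many outcomes, but at least $v_i/2^k$ remains above the lower step, and
$v_i>2^kB_i$ makes this exceed the budget.

On a wall both critical prices are equal, and either result of the coin leads to a wall of the
shorter game or to a zero budget (`UtilityShape.utility_jump`). The value is thus an average of two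
earlier values, and Pascal's rule for $\phi$ solves the recursion (`utility_at_jump`). -/

namespace SeqAuction

/-! ### Prices determined by an indifference equation -/

/-- A jointly continuous function that is strictly increasing in the first and nonincreasing in the
second variable. -/
structure Regular (A : ℝ → ℝ → ℝ) : Prop where
  cont : Continuous fun z : ℝ × ℝ => A z.1 z.2
  mono : ∀ y, StrictMono fun x => A x y
  anti : ∀ x, Antitone (A x)

/-- The price `p` with `p + n * B x (y - p) = (n + 1) * A (x - p) y`. -/
noncomputable def balancePrice (A B : ℝ → ℝ → ℝ) (n : ℕ) (x y : ℝ) : ℝ :=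
  sSup {p : ℝ | p + n * B x (y - p) ≤ (n + 1) * A (x - p) y}

theorem strictMono_balance {A B : ℝ → ℝ → ℝ} (hA : Regular A) (hB : Regular B) (n : ℕ) (x y : ℝ) :
    StrictMono fun p => p + n * B x (y - p) - (n + 1) * A (x - p) y := by
  intro p q hpq
  have h1 : B x (y - p) ≤ B x (y - q) := hB.anti x (by linarith)
  have h2 : A (x - q) y < A (x - p) y := hA.mono y (by linarith)
  have hn : (0 : ℝ) ≤ n := n.cast_nonneg
  have h3 := mul_le_mul_of_nonneg_left h1 hn
  have h4 := mul_le_mul_of_nonneg_left h2.le (by linarith : (0 : ℝ) ≤ n + 1)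
  simp only
  linarith

theorem continuous_balance {A B : ℝ → ℝ → ℝ} (hA : Regular A) (hB : Regular B) (n : ℕ) :
    Continuous fun w : (ℝ × ℝ) × ℝ =>
      w.2 + n * B w.1.1 (w.1.2 - w.2) - (n + 1) * A (w.1.1 - w.2) w.1.2 := by
  have h1 : Continuous fun w : (ℝ × ℝ) × ℝ => B w.1.1 (w.1.2 - w.2) :=
    hB.cont.comp (f := fun w : (ℝ × ℝ) × ℝ => (w.1.1, w.1.2 - w.2)) (by fun_prop)
  have h2 : Continuous fun w : (ℝ × ℝ) × ℝ => A (w.1.1 - w.2) w.1.2 :=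
    hA.cont.comp (f := fun w : (ℝ × ℝ) × ℝ => (w.1.1 - w.2, w.1.2)) (by fun_prop)
  exact (continuous_snd.add (continuous_const.mul h1)).sub (continuous_const.mul h2)

theorem balancePrice_spec {A B : ℝ → ℝ → ℝ} (hA : Regular A) (hB : Regular B) (n : ℕ) (x y : ℝ) :
    balancePrice A B n x y + n * B x (y - balancePrice A B n x y)
      = (n + 1) * A (x - balancePrice A B n x y) y := by
  have hmono := strictMono_balance hA hB n x y
  have hcont : Continuous fun p => p + n * B x (y - p) - (n + 1) * A (x - p) y :=
    (continuous_balance hA hB n).comp (f := fun p => ((x, y), p)) (by fun_prop)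
  set h : ℝ → ℝ := fun p => p + n * B x (y - p) - (n + 1) * A (x - p) y with hh
  have hn : (0 : ℝ) ≤ n := n.cast_nonneg
  -- The balance grows at least as fast as `p` itself, so it has a root between `-|h 0|` and `|h
  -- 0|`.
  have hgrow : ∀ p q, p ≤ q → h p + (q - p) ≤ h q := by
    intro p q hpq
    have h1 : B x (y - p) ≤ B x (y - q) := hB.anti x (by linarith)
    have h2 : A (x - q) y ≤ A (x - p) y := (hA.mono y).monotone (by linarith)
    have h3 := mul_le_mul_of_nonneg_left h1 hn
    have h4 := mul_le_mul_of_nonneg_left h2 (by linarith : (0 : ℝ) ≤ n + 1)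
    simp only [hh]
    linarith
  have habs := abs_nonneg (h 0)
  have hlo := hgrow (-|h 0|) 0 (by linarith)
  have hhi := hgrow 0 |h 0| habs
  have hmem : (0 : ℝ) ∈ Set.Icc (h (-|h 0|)) (h |h 0|) :=
    ⟨by linarith [le_abs_self (h 0)], by linarith [neg_abs_le (h 0)]⟩
  obtain ⟨r, -, hr⟩ := intermediate_value_Icc (by linarith : -|h 0| ≤ |h 0|) hcont.continuousOn hmem
  have hset : {p : ℝ | p + n * B x (y - p) ≤ (n + 1) * A (x - p) y} = Set.Iic r := by
    ext p
    have h1 : h p ≤ h r ↔ p ≤ r := hmono.le_iff_le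
    rw [Set.mem_ofPred_eq, Set.mem_Iic, ← h1, hr, ← sub_nonpos]
  have hroot : balancePrice A B n x y = r := by
    rw [balancePrice, hset, csSup_Iic]
  rw [hroot]
  simp only [hh] at hr
  linarith

theorem continuous_balancePrice {A B : ℝ → ℝ → ℝ} (hA : Regular A) (hB : Regular B) (n : ℕ) :
    Continuous fun z : ℝ × ℝ => balancePrice A B n z.1 z.2 := by
  have hcont := continuous_balance hA hB n
  have hpoint (p : ℝ) : Continuous fun z : ℝ × ℝ =>
      p + n * B z.1 (z.2 - p) - (n + 1) * A (z.1 - p) z.2 :=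
    hcont.comp (f := fun z : ℝ × ℝ => (z, p)) (by fun_prop)
  have hzero (z : ℝ × ℝ) := sub_eq_zero.mpr (balancePrice_spec hA hB n z.1 z.2)
  rw [continuous_iff_continuousAt]
  intro z
  refine tendsto_order.mpr ⟨fun a ha => ?_, fun a ha => ?_⟩
  · have h1 := strictMono_balance hA hB n z.1 z.2 ha
    simp only [hzero z] at h1
    filter_upwards [(hpoint a).continuousAt.eventually (gt_mem_nhds h1)] with w hw
    rw [← (strictMono_balance hA hB n w.1 w.2).lt_iff_lt]
    simpa only [hzero w] using hw
  · have h1 := strictMono_balance hA hB n z.1 z.2 ha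
    simp only [hzero z] at h1
    filter_upwards [(hpoint a).continuousAt.eventually (lt_mem_nhds h1)] with w hw
    rw [← (strictMono_balance hA hB n w.1 w.2).lt_iff_lt]
    simpa only [hzero w] using hw

/-- First price when the agent with budget `x` is to get `m + 1` items, the other one `n + 1`. -/
noncomputable def lowPrice (A B : ℝ → ℝ → ℝ) (m n : ℕ) (x y : ℝ) : ℝ :=
  max (y - (n + 1) * x / (m + 1)) (balancePrice A B n x y)

theorem lowPrice_le {A B : ℝ → ℝ → ℝ} (hA : Regular A) (hB : Regular B) (m n : ℕ) (x y : ℝ) :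
    (n + 1) * A (x - lowPrice A B m n x y) y
      ≤ lowPrice A B m n x y + n * B x (y - lowPrice A B m n x y) := by
  have h := (strictMono_balance hA hB n x y).monotone
    (le_max_right (y - (n + 1) * x / (m + 1)) (balancePrice A B n x y))
  have h0 := balancePrice_spec hA hB n x y
  unfold lowPrice
  linarith

theorem lowPrice_eq {A B : ℝ → ℝ → ℝ} (hA : Regular A) (hB : Regular B) (m n : ℕ) (x y : ℝ)
    (h : y - (n + 1) * x / (m + 1) < lowPrice A B m n x y) :
    (n + 1) * A (x - lowPrice A B m n x y) y
      = lowPrice A B m n x y + n * B x (y - lowPrice A B m n x y) := by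
  have h1 : lowPrice A B m n x y = balancePrice A B n x y := by
    unfold lowPrice at h ⊢
    rcases lt_max_iff.mp h with h | h
    · exact absurd h (lt_irrefl _)
    · exact max_eq_right h.le
  rw [h1]
  exact (balancePrice_spec hA hB n x y).symm

/-- If a change of budgets in the agent's favour does not raise the price, monotonicity of `A`
suffices. If it raises the price, the new price lies strictly above the wall term of the maximum,
hence solves the balance equation; comparing this equation with the inequality `lowPrice_le` at the
old budgets gives the claim. -/
theorem regular_step {A B : ℝ → ℝ → ℝ} (hA : Regular A) (hB : Regular B) (m n : ℕ) :
    Regular fun x y => A (x - lowPrice A B m n x y) y := by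
  have hn : (0 : ℝ) ≤ n := n.cast_nonneg
  have hn1 : (0 : ℝ) < n + 1 := by linarith
  have hm1 : (0 : ℝ) < m + 1 := by positivity
  refine ⟨?_, fun y x x' hx => ?_, fun x y y' hy => ?_⟩
  · have h1 : Continuous fun z : ℝ × ℝ => lowPrice A B m n z.1 z.2 := by
      unfold lowPrice
      have := continuous_balancePrice hA hB n
      fun_prop
    exact hA.cont.comp (f := fun z : ℝ × ℝ => (z.1 - lowPrice A B m n z.1 z.2, z.2)) (by fun_prop)
  · rcases le_or_gt (lowPrice A B m n x' y) (lowPrice A B m n x y) with h | h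
    · exact hA.mono y (by linarith)
    · have hb : y - (n + 1) * x' / (m + 1) < lowPrice A B m n x' y := by
        refine lt_of_le_of_lt ?_ h
        refine le_trans ?_ (le_max_left _ _)
        gcongr
      have h1 := lowPrice_le hA hB m n x y
      have h2 := lowPrice_eq hA hB m n x' y hb
      have h3 : B x (y - lowPrice A B m n x y) ≤ B x' (y - lowPrice A B m n x' y) :=
        ((hB.mono _).monotone hx.le).trans (hB.anti x' (by linarith))
      have h4 := mul_le_mul_of_nonneg_left h3 hn
      exact lt_of_mul_lt_mul_left (by linarith) hn1.le
  · rcases le_or_gt (lowPrice A B m n x y) (lowPrice A B m n x y') with h | h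
    · exact (hA.anti _ hy).trans ((hA.mono y).monotone (by linarith))
    · have hb : y - (n + 1) * x / (m + 1) < lowPrice A B m n x y := by
        refine lt_of_le_of_lt ?_ h
        refine le_trans ?_ (le_max_left _ _)
        linarith
      have h1 := lowPrice_le hA hB m n x y'
      have h2 := lowPrice_eq hA hB m n x y hb
      have h3 : B x (y' - lowPrice A B m n x y') ≤ B x (y - lowPrice A B m n x y) :=
        hB.anti x (by linarith)
      have h4 := mul_le_mul_of_nonneg_left h3 hn
      exact le_of_mul_le_mul_left (by linarith) hn1

/-! ### Leftover money of the poorer agent -/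

/-- Money that the agent with budget `x` has left when she gets `m` items, her opponent (budget `y`)
gets `n` items, and `(n + 1) * x ≤ (m + 1) * y`. -/
noncomputable def reserve : ℕ → ℕ → ℝ → ℝ → ℝ
  | 0, _ => fun x _ => x
  | m + 1, 0 => fun x y => x - (m + 1) * y
  | m + 1, n + 1 => fun x y =>
      reserve m (n + 1) (x - lowPrice (reserve m (n + 1)) (reserve (m + 1) n) m n x y) y

theorem regular_reserve (m n : ℕ) : Regular (reserve m n) := by
  induction m generalizing n with
  | zero =>
    rw [reserve]
    exact ⟨by fun_prop, fun _ _ _ h => h, fun _ _ _ _ => le_rfl⟩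
  | succ m ihm =>
    induction n with
    | zero =>
      rw [reserve]
      refine ⟨by fun_prop, fun _ _ _ h => by simpa using h, fun _ a b h => ?_⟩
      have := mul_le_mul_of_nonneg_left h (by positivity : (0 : ℝ) ≤ m + 1)
      linarith
    | succ n ihn =>
      rw [reserve]
      exact regular_step (ihm (n + 1)) ihn m n

theorem reserve_zero_left (n : ℕ) (x y : ℝ) : reserve 0 n x y = x := by rw [reserve]

theorem reserve_zero_right (m : ℕ) (x y : ℝ) : reserve m 0 x y = x - m * y := by
  cases m with
  | zero => simp [reserve]
  | succ m => rw [reserve]; push_cast; rfl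

/-- The first price of the game described by `reserve (m + 1) (n + 1)`. -/
noncomputable def firstPrice (m n : ℕ) (x y : ℝ) : ℝ :=
  lowPrice (reserve m (n + 1)) (reserve (m + 1) n) m n x y

theorem reserve_succ (m n : ℕ) (x y : ℝ) :
    reserve (m + 1) (n + 1) x y = reserve m (n + 1) (x - firstPrice m n x y) y := by
  rw [reserve, firstPrice]

theorem le_firstPrice (m n : ℕ) (x y : ℝ) :
    (m + 1) * y - (n + 1) * x ≤ (m + 1) * firstPrice m n x y := by
  have hm1 : (0 : ℝ) < m + 1 := by positivity
  have h : y - (n + 1) * x / (m + 1) ≤ firstPrice m n x y := le_max_left _ _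
  have := mul_le_mul_of_nonneg_left h hm1.le
  rwa [mul_sub, mul_div_cancel₀ _ hm1.ne'] at this

theorem reserve_le (m n : ℕ) (x y : ℝ) :
    (n + 1) * reserve (m + 1) (n + 1) x y
      ≤ firstPrice m n x y + n * reserve (m + 1) n x (y - firstPrice m n x y) := by
  rw [reserve_succ]
  exact lowPrice_le (regular_reserve _ _) (regular_reserve _ _) m n x y

theorem reserve_eq (m n : ℕ) (x y : ℝ)
    (h : (m + 1) * y - (n + 1) * x < (m + 1) * firstPrice m n x y) :
    (n + 1) * reserve (m + 1) (n + 1) x y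
      = firstPrice m n x y + n * reserve (m + 1) n x (y - firstPrice m n x y) := by
  have hm1 : (0 : ℝ) < m + 1 := by positivity
  rw [reserve_succ]
  refine lowPrice_eq (regular_reserve _ _) (regular_reserve _ _) m n x y ?_
  refine lt_of_mul_lt_mul_left ?_ hm1.le
  rwa [mul_sub, mul_div_cancel₀ _ hm1.ne']

/-- With $m+1$ and $n+1$ units of money the first price is one unit, and winning keeps the budgets
in the analogous proportion. Any other price contradicts the balance relation. -/
theorem reserve_diag (m n : ℕ) {u : ℝ} (hu : 0 ≤ u) :
    reserve m n ((m + 1) * u) ((n + 1) * u) = u := by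
  induction m generalizing n with
  | zero => simp [reserve_zero_left]
  | succ m ihm =>
    induction n with
    | zero => rw [reserve_zero_right]; push_cast; ring
    | succ n ihn =>
      have hA := regular_reserve m (n + 1)
      have hB := regular_reserve (m + 1) n
      have h1 := ihm (n + 1)
      push_cast at h1 ihn ⊢
      set X : ℝ := (m + 1 + 1) * u with hX
      set Y : ℝ := (n + 1 + 1) * u with hY
      set p := firstPrice m n X Y with hp
      have hn : (0 : ℝ) ≤ n := n.cast_nonneg
      have hn1 : (0 : ℝ) < n + 1 := by linarith
      have hs := reserve_succ m n X Y
      have hle := reserve_le m n X Y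
      have heq := reserve_eq m n X Y
      rw [← hp] at hs hle heq
      rcases lt_trichotomy p u with h | h | h
      · exfalso
        have h2 := hA.mono Y (by rw [hX]; linarith : (m + 1) * u < X - p)
        have h3 := hB.anti X (by rw [hY]; linarith : (n + 1) * u ≤ Y - p)
        simp only [h1, ihn, ← hs] at h2 h3
        have h4 := mul_lt_mul_of_pos_left h2 hn1
        have h5 := mul_le_mul_of_nonneg_left h3 hn
        linarith
      · rw [hs, h, ← h1]
        congr 1
        rw [h1, hX]; ring
      · exfalso
        have h2 := hA.mono Y (by rw [hX]; linarith : X - p < (m + 1) * u)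
        have h3 := hB.anti X (by rw [hY]; linarith : Y - p ≤ (n + 1) * u)
        simp only [h1, ihn, ← hs] at h2 h3
        have h4 := mul_lt_mul_of_pos_left h2 hn1
        have h5 := mul_le_mul_of_nonneg_left h3 hn
        have h6 : (m + 1) * u < (m + 1) * p := mul_lt_mul_of_pos_left h (by positivity)
        have h7 : 0 ≤ n * u := mul_nonneg hn hu
        have := heq (by rw [hX, hY]; nlinarith)
        linarith

/-- Here the wall term forces the price up to at least `u`; a higher price would solve the balance
equation with a negative left side and a positive right side. -/
theorem reserve_boundary (m n : ℕ) {u : ℝ} (hu : 0 ≤ u) :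
    reserve m n (m * u) ((n + 1) * u) = 0 := by
  induction m generalizing n with
  | zero => simp [reserve_zero_left]
  | succ m ihm =>
    induction n with
    | zero => rw [reserve_zero_right]; push_cast; ring
    | succ n ihn =>
      have hA := regular_reserve m (n + 1)
      have hB := regular_reserve (m + 1) n
      have h1 := ihm (n + 1)
      push_cast at h1 ihn ⊢
      set X : ℝ := (m + 1) * u with hX
      set Y : ℝ := (n + 1 + 1) * u with hY
      set p := firstPrice m n X Y with hp
      have hn : (0 : ℝ) ≤ n := n.cast_nonneg
      have hn1 : (0 : ℝ) < n + 1 := by linarith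
      have hm1 : (0 : ℝ) < m + 1 := by positivity
      have hs := reserve_succ m n X Y
      have hb := le_firstPrice m n X Y
      have heq := reserve_eq m n X Y
      rw [← hp] at hs hb heq
      have hpu : u ≤ p := by
        refine le_of_mul_le_mul_left (le_of_eq_of_le ?_ hb) hm1
        rw [hX, hY]; ring
      rcases hpu.eq_or_lt with h | h
      · rw [hs, ← h, ← h1]
        congr 1
        rw [hX]; ring
      · exfalso
        have h2 := hA.mono Y (by rw [hX]; linarith : X - p < m * u)
        have h3 := hB.anti X (by rw [hY]; linarith : Y - p ≤ (n + 1) * u)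
        simp only [h1, ihn, ← hs] at h2 h3
        have h4 := mul_lt_mul_of_pos_left h2 hn1
        have h5 := mul_nonneg hn h3
        have h6 : (m + 1) * u < (m + 1) * p := mul_lt_mul_of_pos_left h hm1
        have := heq (by rw [hX, hY]; linarith)
        linarith

/-- The price bound for `m` uses the reserve bound for `m`, which in turn uses the price bound for
`m - 1`; hence the joint statement. The comparison state is the diagonal of `reserve_diag`, with
unit $u=x/(m+2)$. The price bound means that an opponent who wins at the first price remains the
richer one for the item counts $(m+1,n)$. -/
theorem reserve_le_and_firstPrice_le (m : ℕ) :
    (∀ (n : ℕ) {x y : ℝ}, 0 ≤ x → 0 ≤ y → (n + 1) * x ≤ (m + 1) * y →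
      (m + 1) * reserve m n x y ≤ x) ∧
    ∀ (n : ℕ) {x y : ℝ}, 0 ≤ x → 0 ≤ y → (n + 2) * x ≤ (m + 2) * y →
      (m + 2) * firstPrice m n x y ≤ (m + 2) * y - (n + 1) * x := by
  have key : ∀ m : ℕ, (∀ (n : ℕ) {x y : ℝ}, 0 ≤ x → 0 ≤ y → (n + 1) * x ≤ (m + 1) * y →
      (m + 1) * reserve m n x y ≤ x) →
      ∀ (n : ℕ) {x y : ℝ}, 0 ≤ x → 0 ≤ y → (n + 2) * x ≤ (m + 2) * y →
      (m + 2) * firstPrice m n x y ≤ (m + 2) * y - (n + 1) * x := by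
    intro m hm n x y hx hy hxy
    by_contra! hlt
    have hA := regular_reserve m (n + 1)
    have hB := regular_reserve (m + 1) n
    have hn : (0 : ℝ) ≤ n := n.cast_nonneg
    have hm0 : (0 : ℝ) ≤ m := m.cast_nonneg
    have hm2 : (0 : ℝ) < m + 2 := by linarith
    obtain ⟨u, rfl⟩ : ∃ u, x = (m + 2) * u := ⟨x / (m + 2), by field_simp⟩
    have hu : 0 ≤ u := nonneg_of_mul_nonneg_right hx hm2
    have hs := reserve_succ m n ((m + 2) * u) y
    have heq := reserve_eq m n ((m + 2) * u) y
    set p := firstPrice m n ((m + 2) * u) y with hp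
    have hyu : (n + 2) * u ≤ y := le_of_mul_le_mul_left (by linarith) hm2
    have hpu : y - (n + 1) * u < p := lt_of_mul_lt_mul_left (by linarith) hm2.le
    have h1 := hA.mono y (by linarith : (m + 2) * u - p < (m + 1) * u)
    have h2 := hm (n + 1) (x := (m + 1) * u) (y := y) (by positivity) hy
      (by push_cast; nlinarith)
    have h2 : reserve m (n + 1) ((m + 1) * u) y ≤ u :=
      le_of_mul_le_mul_left h2 (by linarith)
    have h3 := hB.anti ((m + 2) * u) (by linarith : y - p ≤ (n + 1) * u)
    have h4 := reserve_diag (m + 1) n hu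
    have h5 : (((m + 1 : ℕ) : ℝ) + 1) * u = (m + 2) * u := by push_cast; ring
    rw [h5] at h4
    have h6 := mul_le_mul_of_nonneg_left (h4 ▸ h3) hn
    have h7 := heq (by nlinarith)
    have h8 : reserve (m + 1) (n + 1) ((m + 2) * u) y < u := by
      rw [hs]; exact h1.trans_le h2
    have h9 := mul_lt_mul_of_pos_left h8 (by linarith : (0 : ℝ) < n + 1)
    linarith
  have main : ∀ m : ℕ, ∀ (n : ℕ) {x y : ℝ}, 0 ≤ x → 0 ≤ y → (n + 1) * x ≤ (m + 1) * y →
      (m + 1) * reserve m n x y ≤ x := by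
    intro m
    induction m with
    | zero => intro n x y hx hy hxy; simp [reserve_zero_left]
    | succ m ihm =>
      intro n
      induction n with
      | zero =>
        intro x y hx hy hxy
        rw [reserve_zero_right]
        push_cast at hxy ⊢
        nlinarith [mul_le_mul_of_nonneg_left hxy (by positivity : (0 : ℝ) ≤ m + 1)]
      | succ n ihn =>
        intro x y hx hy hxy
        push_cast at hxy ⊢
        have hn : (0 : ℝ) ≤ n := n.cast_nonneg
        have hm0 : (0 : ℝ) ≤ m := m.cast_nonneg
        have hm2 : (0 : ℝ) < m + 2 := by linarith
        have hple := key m ihm n hx hy (by linarith)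
        obtain ⟨u, rfl⟩ : ∃ u, x = (m + 2) * u := ⟨x / (m + 2), by field_simp⟩
        have hu : 0 ≤ u := nonneg_of_mul_nonneg_right hx hm2
        have hyu : (n + 2) * u ≤ y := le_of_mul_le_mul_left (by linarith) hm2
        have hs := reserve_succ m n ((m + 2) * u) y
        have hle := reserve_le m n ((m + 2) * u) y
        set p := firstPrice m n ((m + 2) * u) y with hp
        have hpu : p ≤ y - (n + 1) * u := le_of_mul_le_mul_left (by linarith) hm2
        suffices h : reserve (m + 1) (n + 1) ((m + 2) * u) y ≤ u by nlinarith
        rcases le_or_gt u p with h | h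
        · have h1 := ((regular_reserve m (n + 1)).mono y).monotone
            (by linarith : (m + 2) * u - p ≤ (m + 1) * u)
          have h2 := ihm (n + 1) (x := (m + 1) * u) (y := y) (by positivity) hy
            (by push_cast; nlinarith)
          rw [hs]
          exact h1.trans (le_of_mul_le_mul_left h2 (by linarith))
        · have hnu : 0 ≤ n * u := mul_nonneg hn hu
          have h1 := ihn hx (y := y - p) (by linarith) (by push_cast; nlinarith)
          push_cast at h1
          have h2 : reserve (m + 1) n ((m + 2) * u) (y - p) ≤ u :=
            le_of_mul_le_mul_left (by linarith) hm2
          have h3 := mul_le_mul_of_nonneg_left h2 hn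
          exact le_of_mul_le_mul_left (by linarith) (by linarith : (0 : ℝ) < n + 1)
  exact ⟨main m, key m (main m)⟩

theorem mul_reserve_le (m n : ℕ) {x y : ℝ} (hx : 0 ≤ x) (hy : 0 ≤ y)
    (h : (n + 1) * x ≤ (m + 1) * y) : (m + 1) * reserve m n x y ≤ x :=
  (reserve_le_and_firstPrice_le m).1 n hx hy h

theorem firstPrice_le (m n : ℕ) {x y : ℝ} (hx : 0 ≤ x) (hy : 0 ≤ y)
    (h : (n + 2) * x ≤ (m + 2) * y) :
    (m + 2) * firstPrice m n x y ≤ (m + 2) * y - (n + 1) * x :=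
  (reserve_le_and_firstPrice_le m).2 n hx hy h

/-- Counterpart of `firstPrice_le`: after winning at the first price the agent is still the poorer
one, now for the item counts $(m,n+1)$. Too low a price would leave her more than $u=y/(n+2)$,
against the balance inequality. -/
theorem firstPrice_ge (m n : ℕ) {x y : ℝ} (hx : 0 ≤ x) (hy : 0 ≤ y)
    (hxy : (n + 2) * x ≤ (m + 2) * y) :
    (n + 2) * x - (m + 1) * y ≤ (n + 2) * firstPrice m n x y := by
  by_contra! hlt
  have hn : (0 : ℝ) ≤ n := n.cast_nonneg
  have hm0 : (0 : ℝ) ≤ m := m.cast_nonneg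
  have hn2 : (0 : ℝ) < n + 2 := by linarith
  obtain ⟨u, rfl⟩ : ∃ u, y = (n + 2) * u := ⟨y / (n + 2), by field_simp⟩
  have hu : 0 ≤ u := nonneg_of_mul_nonneg_right hy hn2
  have hs := reserve_succ m n x ((n + 2) * u)
  have hle := reserve_le m n x ((n + 2) * u)
  set p := firstPrice m n x ((n + 2) * u) with hp
  have hxu : x ≤ (m + 2) * u := le_of_mul_le_mul_left (by linarith) hn2
  have hpu : p < x - (m + 1) * u := lt_of_mul_lt_mul_left (by linarith) hn2.le
  have h1 := (regular_reserve m (n + 1)).mono ((n + 2) * u)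
    (by linarith : (m + 1) * u < x - p)
  have h2 := reserve_diag m (n + 1) hu
  have h3 : (((n + 1 : ℕ) : ℝ) + 1) * u = (n + 2) * u := by push_cast; ring
  rw [h3] at h2
  have h4 := (regular_reserve (m + 1) n).anti x
    (by linarith : (n + 1) * u ≤ (n + 2) * u - p)
  have h5 := mul_reserve_le (m + 1) n hx (y := (n + 1) * u) (by positivity)
    (by push_cast; nlinarith)
  push_cast at h5
  have h6 : reserve (m + 1) n x ((n + 1) * u) ≤ u :=
    le_of_mul_le_mul_left (by linarith) (by linarith : (0 : ℝ) < m + 2)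
  have h7 := mul_le_mul_of_nonneg_left (h4.trans h6) hn
  simp only [h2, ← hs] at h1
  have h8 := mul_lt_mul_of_pos_left h1 (by linarith : (0 : ℝ) < n + 1)
  linarith

theorem reserve_pos (m n : ℕ) {x y : ℝ} (hx : 0 < x) (hy : 0 ≤ y) (hlow : m * y < (n + 1) * x)
    (hxy : (n + 1) * x ≤ (m + 1) * y) : 0 < reserve m n x y := by
  induction m generalizing n x y with
  | zero => rwa [reserve_zero_left]
  | succ m ihm =>
    induction n generalizing y with
    | zero =>
      rw [reserve_zero_right]
      simp only [Nat.cast_zero] at hlow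
      linarith
    | succ n ihn =>
      push_cast at hlow hxy
      have hn : (0 : ℝ) ≤ n := n.cast_nonneg
      have hm0 : (0 : ℝ) ≤ m := m.cast_nonneg
      have hge := firstPrice_ge m n hx.le hy (by linarith)
      have hle := firstPrice_le m n hx.le hy (by linarith)
      have hs := reserve_succ m n x y
      have hb := le_firstPrice m n x y
      have heq := reserve_eq m n x y
      set p := firstPrice m n x y with hp
      have hp0 : 0 < p := pos_of_mul_pos_right (by linarith : 0 < (n + 2) * p) (by linarith)
      -- If the price is the wall term, follow the agent's win; otherwise the balance equation
      -- writes the reserve as a positive price plus a nonnegative term.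
      rcases hb.eq_or_lt with h | h
      · rw [hs]
        have h1 : (m : ℝ) * y < (n + 2) * (x - p) := by
          have h2 : (m + n + 2) * ((m + 1) * y) < (m + n + 2) * ((n + 2) * x) :=
            mul_lt_mul_of_pos_left (by linarith) (by linarith)
          refine lt_of_mul_lt_mul_left ?_ (by linarith : (0 : ℝ) ≤ m + 1)
          linear_combination h2 - (n + 2) * h
        have h3 : 0 < x - p :=
          pos_of_mul_pos_right ((mul_nonneg hm0 hy).trans_lt h1) (by linarith)
        exact ihm (n + 1) h3 hy (by push_cast; linarith) (by push_cast; linarith)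
      · have h1 := heq h
        have hyp : (n + 1) * x ≤ (m + 2) * (y - p) := by linarith
        have hyp0 : 0 ≤ y - p := nonneg_of_mul_nonneg_right
          (le_trans (by positivity) hyp) (by linarith : (0 : ℝ) < m + 2)
        have h2 := ihn hyp0 (by push_cast; linarith) (by push_cast; linarith)
        have h3 := mul_nonneg hn h2.le
        exact pos_of_mul_pos_right (by linarith :
          0 < ((n : ℝ) + 1) * reserve (m + 1) (n + 1) x y) (by linarith)

theorem lt_of_reserve_pos (m n : ℕ) {x y : ℝ} (hy : 0 ≤ y) (h : 0 < reserve m n x y) :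
    m * y < (n + 1) * x := by
  by_contra! hle
  have hn1 : (0 : ℝ) < n + 1 := by positivity
  have h1 := reserve_boundary m n (u := y / (n + 1)) (by positivity)
  rw [mul_div_cancel₀ y hn1.ne'] at h1
  have h2 : x ≤ m * (y / (n + 1)) := by
    rw [← mul_div_assoc, le_div_iff₀ hn1]
    linarith
  have h3 := ((regular_reserve m n).mono y).monotone h2
  simp only [h1] at h3
  linarith

/-- At the first price the poorer agent does not prefer losing. -/
theorem reserve_lose_le (m n : ℕ) {x y : ℝ} (hx : 0 < x) (hy : 0 ≤ y)
    (hlow : (m + 1) * y < (n + 2) * x) (hxy : (n + 2) * x ≤ (m + 2) * y) :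
    reserve (m + 1) n x (y - firstPrice m n x y) ≤ reserve (m + 1) (n + 1) x y := by
  induction m generalizing n x y with
  | zero =>
    simp only [Nat.cast_zero] at hlow hxy
    have hn : (0 : ℝ) ≤ n := n.cast_nonneg
    have hpos := reserve_pos 1 (n + 1) hx hy (by push_cast; linarith) (by push_cast; linarith)
    have hle := firstPrice_le 0 n hx.le hy (by push_cast; linarith)
    have hs := reserve_succ 0 n x y
    have hb := le_firstPrice 0 n x y
    have heq := reserve_eq 0 n x y
    set p := firstPrice 0 n x y with hp
    simp only [Nat.cast_zero, zero_add] at hs hle hb heq ⊢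
    have hnx : 0 ≤ n * x := mul_nonneg hn hx.le
    rcases hb.eq_or_lt with h | h
    · have h1 := reserve_boundary 1 n hx.le
      rw [show y - p = (n + 1) * x by linarith]
      simp only [Nat.cast_one, one_mul] at h1
      rw [h1]
      exact hpos.le
    · have h1 := heq h
      have h2 := mul_reserve_le 1 n hx.le (y := y - p) (by linarith) (by push_cast; linarith)
      rw [reserve_zero_left] at hs
      by_contra! hlt
      have h3 := mul_le_mul_of_nonneg_left hlt.le hn
      simp only [Nat.cast_one] at h2
      linarith
  | succ m ihm =>
    -- `r` stands for the price of the round that follows a loss. The cases `n = 0` and `n + 1`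
    -- supply it differently, so it enters as a hypothesis.
    have step : ∀ (n : ℕ) {y : ℝ}, 0 ≤ y → ((m : ℝ) + 2) * y < (n + 2) * x →
        (n + 2) * x ≤ ((m : ℝ) + 3) * y →
        (((m : ℝ) + 2) * y - (n + 1) * x < (m + 2) * firstPrice (m + 1) n x y →
          ∃ r, reserve (m + 2) n x (y - firstPrice (m + 1) n x y)
              = reserve (m + 1) n (x - r) (y - firstPrice (m + 1) n x y) ∧
            reserve (m + 2) n x (y - firstPrice (m + 1) n x y) ≤ r) →
        reserve (m + 2) n x (y - firstPrice (m + 1) n x y) ≤ reserve (m + 2) (n + 1) x y := by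
      intro n y hy hlow hxy hr
      have hn : (0 : ℝ) ≤ n := n.cast_nonneg
      have hm0 : (0 : ℝ) ≤ m := m.cast_nonneg
      have hpos := reserve_pos (m + 2) (n + 1) hx hy (by push_cast; linarith)
        (by push_cast; linarith)
      have hge := firstPrice_ge (m + 1) n hx.le hy (by push_cast; linarith)
      have hs := reserve_succ (m + 1) n x y
      have hb := le_firstPrice (m + 1) n x y
      have heq := reserve_eq (m + 1) n x y
      set p := firstPrice (m + 1) n x y with hp
      push_cast at hge hb heq
      rcases hb.eq_or_lt with h | h
      · have h1 := reserve_boundary (m + 2) n (u := x / (m + 2)) (by positivity)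
        have h2 : ((m + 2 : ℕ) : ℝ) * (x / (m + 2)) = x := by push_cast; field_simp
        have h3 : y - p = (n + 1) * (x / (m + 2)) := by field_simp; linarith
        rw [h3]
        rw [h2] at h1
        rw [h1]
        exact hpos.le
      · have h1 := heq h
        obtain ⟨r, hr1, hr2⟩ := hr (by linarith)
        -- Exchange argument. If losing were better, `s < t`, the balance equation gives `p ≤ s`.
        -- The next price `q` after a win satisfies `s ≤ q` by induction, and the next price `r`
        -- after a loss satisfies `t ≤ r`. So `p ≤ q` and `p ≤ r`, and monotonicity bounds `t` by
        -- the reserve after a win at `p` and a loss at `q`, which is at most `s`.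
        by_contra! hlt
        set t := reserve (m + 2) n x (y - p) with ht
        set s := reserve (m + 2) (n + 1) x y with hs'
        have h2 := mul_le_mul_of_nonneg_left hlt.le hn
        have hps : p ≤ s := by linarith
        have hup := lt_of_reserve_pos (m + 1) (n + 1) hy (hs ▸ hpos)
        push_cast at hup
        have hxp : 0 < x - p :=
          pos_of_mul_pos_right (lt_of_le_of_lt (by positivity) hup)
            (by linarith : 0 ≤ (n : ℝ) + 1 + 1)
        have hw := ihm n hxp hy (by linarith) (by linarith)
        have hqle := reserve_le m n (x - p) y
        set q := firstPrice m n (x - p) y with hq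
        rw [← hs] at hw hqle
        have h3 := mul_le_mul_of_nonneg_left hw hn
        have hsq : s ≤ q := by linarith
        have h4 := ((regular_reserve (m + 1) n).mono (y - p)).monotone
          (by linarith : x - r ≤ x - p)
        have h5 := (regular_reserve (m + 1) n).anti (x - p) (by linarith : y - q ≤ y - p)
        linarith
    have after : ∀ (n : ℕ) {y : ℝ}, 0 ≤ y → (n + 2) * x ≤ ((m : ℝ) + 3) * y →
        (n + 1) * x ≤ (m + 3) * (y - firstPrice (m + 1) n x y) ∧
        0 ≤ y - firstPrice (m + 1) n x y ∧
        (m + 3) * reserve (m + 2) n x (y - firstPrice (m + 1) n x y) ≤ x := by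
      intro n y hy hxy
      have hle := firstPrice_le (m + 1) n hx.le hy (by push_cast; linarith)
      have hm0 : (0 : ℝ) ≤ m := m.cast_nonneg
      push_cast at hle
      have h1 : (n + 1) * x ≤ (m + 3) * (y - firstPrice (m + 1) n x y) := by linarith
      have h2 : 0 ≤ y - firstPrice (m + 1) n x y := nonneg_of_mul_nonneg_right
        (le_trans (by positivity) h1) (by linarith : (0 : ℝ) < m + 3)
      have h3 := mul_reserve_le (m + 2) n hx.le h2 (by push_cast; linarith)
      push_cast at h3
      exact ⟨h1, h2, by linarith⟩
    have hm3 : (0 : ℝ) < m + 3 := by positivity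
    push_cast at hlow hxy
    induction n generalizing y with
    | zero =>
      simp only [Nat.cast_zero] at hlow hxy
      refine step 0 hy (by push_cast; linarith) (by push_cast; linarith) fun _ => ?_
      obtain ⟨h1, h2, h3⟩ := after 0 hy (by push_cast; linarith)
      simp only [Nat.cast_zero] at h1
      -- An opponent who gets no further item makes the agent pay the opponent's whole remaining
      -- budget for each of hers.
      refine ⟨y - firstPrice (m + 1) 0 x y, ?_, le_of_mul_le_mul_left (by linarith) hm3⟩
      rw [reserve_zero_right, reserve_zero_right]; push_cast; ring
    | succ n ihn =>
      push_cast at hlow hxy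
      refine step (n + 1) hy (by push_cast; linarith) (by push_cast; linarith) fun hb => ?_
      obtain ⟨h1, h2, h3⟩ := after (n + 1) hy (by push_cast; linarith)
      push_cast at h1 hb
      set y' := y - firstPrice (m + 1) (n + 1) x y with hy'
      have hlow' : (m + 1 + 1) * y' < (n + 2) * x := by
        rw [hy']; linarith
      refine ⟨firstPrice (m + 1) n x y', reserve_succ (m + 1) n x y', ?_⟩
      have h4 := ihn h2 hlow' (by linarith)
      have h5 := reserve_le (m + 1) n x y'
      have h6 := mul_le_mul_of_nonneg_left h4 n.cast_nonneg
      linarith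

/-! ### Leftover money on a whole cell -/

/-- Money that the agent with budget `x` has left when she gets `m` items and her opponent, with
budget `y`, gets `n` items. -/
noncomputable def leftover (m n : ℕ) (x y : ℝ) : ℝ :=
  if (n + 1) * x ≤ (m + 1) * y then reserve m n x y else x - m * reserve n m y x

theorem leftover_of_le (m n : ℕ) {x y : ℝ} (h : (n + 1) * x ≤ (m + 1) * y) :
    leftover m n x y = reserve m n x y := if_pos h

/-- On the ray $x:y=(m+1):(n+1)$ both reserves equal the common unit, so the two branches of
`leftover` glue. -/
theorem reserve_add_mul_reserve (m n : ℕ) {x y : ℝ} (hx : 0 ≤ x)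
    (h : (n + 1) * x = (m + 1) * y) : reserve m n x y = x - m * reserve n m y x := by
  have hm1 : (0 : ℝ) < m + 1 := by positivity
  obtain ⟨u, rfl⟩ : ∃ u, x = (m + 1) * u := ⟨x / (m + 1), by field_simp⟩
  have hu : 0 ≤ u := nonneg_of_mul_nonneg_right hx hm1
  obtain rfl : y = (n + 1) * u := mul_left_cancel₀ hm1.ne' (by linarith)
  rw [reserve_diag m n hu, reserve_diag n m hu]
  ring

theorem leftover_of_ge (m n : ℕ) {x y : ℝ} (hx : 0 ≤ x) (h : (m + 1) * y ≤ (n + 1) * x) :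
    leftover m n x y = x - m * reserve n m y x := by
  unfold leftover
  split_ifs with h1
  · exact reserve_add_mul_reserve m n hx (le_antisymm h1 h)
  · rfl

theorem leftover_lt (m n : ℕ) {x x' y : ℝ} (hx : 0 ≤ x) (hy : 0 ≤ y) (h : x < x') :
    leftover m n x y < leftover m n x' y := by
  have hn1 : (0 : ℝ) < n + 1 := by positivity
  have small : ∀ {a b : ℝ}, a < b → (n + 1) * b ≤ (m + 1) * y →
      leftover m n a y < leftover m n b y := by
    intro a b hab hb
    rw [leftover_of_le m n hb, leftover_of_le m n (by nlinarith)]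
    exact (regular_reserve m n).mono y hab
  have big : ∀ {a b : ℝ}, 0 ≤ a → a < b → (m + 1) * y ≤ (n + 1) * a →
      leftover m n a y < leftover m n b y := by
    intro a b ha hab hb
    rw [leftover_of_ge m n ha hb, leftover_of_ge m n (ha.trans hab.le) (by nlinarith)]
    have := mul_le_mul_of_nonneg_left ((regular_reserve n m).anti y hab.le) m.cast_nonneg
    linarith
  rcases le_or_gt ((n + 1) * x') ((m + 1) * y) with h1 | h1
  · exact small h h1
  rcases le_or_gt ((m + 1) * y) ((n + 1) * x) with h2 | h2
  · exact big hx h h2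
  -- The budget at which the two branches meet serves as intermediate point.
  have h3 : (n + 1) * ((m + 1) * y / (n + 1)) = (m + 1) * y := mul_div_cancel₀ _ hn1.ne'
  exact (small ((lt_div_iff₀' hn1).mpr h2) h3.le).trans
    (big (by positivity) ((div_lt_iff₀' hn1).mpr h1) h3.ge)

theorem leftover_anti (m n : ℕ) {x y y' : ℝ} (hx : 0 ≤ x) (h : y ≤ y') :
    leftover m n x y' ≤ leftover m n x y := by
  have hm1 : (0 : ℝ) < m + 1 := by positivity
  have small : ∀ {a b : ℝ}, a ≤ b → (n + 1) * x ≤ (m + 1) * a →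
      leftover m n x b ≤ leftover m n x a := by
    intro a b hab hb
    rw [leftover_of_le m n hb, leftover_of_le m n (by nlinarith)]
    exact (regular_reserve m n).anti x hab
  have big : ∀ {a b : ℝ}, a ≤ b → (m + 1) * b ≤ (n + 1) * x →
      leftover m n x b ≤ leftover m n x a := by
    intro a b hab hb
    rw [leftover_of_ge m n hx hb, leftover_of_ge m n hx (by nlinarith)]
    have := mul_le_mul_of_nonneg_left (((regular_reserve n m).mono x).monotone hab)
      (m.cast_nonneg (α := ℝ))
    linarith
  rcases le_or_gt ((m + 1) * y') ((n + 1) * x) with h1 | h1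
  · exact big h h1
  rcases le_or_gt ((n + 1) * x) ((m + 1) * y) with h2 | h2
  · exact small h h2
  have h3 : (m + 1) * ((n + 1) * x / (m + 1)) = (n + 1) * x := mul_div_cancel₀ _ hm1.ne'
  exact (small ((div_le_iff₀' hm1).mpr h1.le) h3.ge).trans
    (big ((le_div_iff₀' hm1).mpr h2.le) h3.le)

theorem continuousAt_leftover (m n : ℕ) {x y : ℝ} (hx : 0 ≤ x) :
    ContinuousAt (fun z : ℝ × ℝ => leftover m n z.1 z.2) (x, y) := by
  have h1 : Continuous fun z : ℝ × ℝ => reserve m n z.1 z.2 := (regular_reserve m n).cont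
  have h2 : Continuous fun z : ℝ × ℝ => z.1 - m * reserve n m z.2 z.1 := by
    have : Continuous fun z : ℝ × ℝ => reserve n m z.2 z.1 :=
      (regular_reserve n m).cont.comp (f := fun z : ℝ × ℝ => (z.2, z.1)) (by fun_prop)
    exact continuous_fst.sub (continuous_const.mul this)
  have hl : Continuous fun z : ℝ × ℝ => ((n : ℝ) + 1) * z.1 := by fun_prop
  have hr : Continuous fun z : ℝ × ℝ => ((m : ℝ) + 1) * z.2 := by fun_prop
  rcases lt_trichotomy ((n + 1) * x) ((m + 1) * y) with h | h | h
  · refine h1.continuousAt.congr ?_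
    filter_upwards [hl.continuousAt.eventually_lt hr.continuousAt h] with z hz
    exact (leftover_of_le m n hz.le).symm
  · unfold ContinuousAt leftover
    beta_reduce
    rw [if_pos h.le]
    refine Tendsto.if' (h1.tendsto (x, y)) ?_
    rw [reserve_add_mul_reserve m n hx h]
    exact h2.tendsto (x, y)
  · refine h2.continuousAt.congr ?_
    filter_upwards [hr.continuousAt.eventually_lt hl.continuousAt h] with z hz
    exact (if_neg hz.not_ge).symm

theorem leftover_pos (m n : ℕ) {x y : ℝ} (hx : 0 < x) (hy : 0 ≤ y) (h : m * y < (n + 1) * x) :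
    0 < leftover m n x y := by
  rcases le_or_gt ((n + 1) * x) ((m + 1) * y) with h1 | h1
  · rw [leftover_of_le m n h1]
    exact reserve_pos m n hx hy h h1
  · rw [leftover_of_ge m n hx.le h1.le]
    have hn1 : (0 : ℝ) < n + 1 := by positivity
    have h2 := mul_le_mul_of_nonneg_left (mul_reserve_le n m hy hx.le h1.le)
      (m.cast_nonneg (α := ℝ))
    exact pos_of_mul_pos_right (by linarith : 0 < (n + 1) * (x - m * reserve n m y x)) hn1.le

theorem leftover_le (m n : ℕ) {x y : ℝ} (hx : 0 ≤ x) (hy : 0 < y) (h : n * x < (m + 1) * y) :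
    leftover m n x y ≤ x := by
  have hm : (0 : ℝ) ≤ m := m.cast_nonneg
  rcases le_or_gt ((n + 1) * x) ((m + 1) * y) with h1 | h1
  · rw [leftover_of_le m n h1]
    nlinarith [mul_reserve_le m n hx hy.le h1]
  · rw [leftover_of_ge m n hx h1.le]
    have := mul_nonneg hm (reserve_pos n m hy hx h h1.le).le
    linarith

theorem leftover_lower (m n : ℕ) {x y : ℝ} (hx : 0 ≤ x) (hy : 0 ≤ y) (h : m * y = (n + 1) * x) :
    leftover m n x y = 0 := by
  have hn1 : (0 : ℝ) < n + 1 := by positivity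
  obtain ⟨u, rfl⟩ : ∃ u, y = (n + 1) * u := ⟨y / (n + 1), by field_simp⟩
  obtain rfl : x = m * u := mul_left_cancel₀ hn1.ne' (by linarith)
  rw [leftover_of_le m n (by linarith), reserve_boundary m n (nonneg_of_mul_nonneg_right hy hn1)]

theorem leftover_upper (m n : ℕ) {x y : ℝ} (hx : 0 ≤ x) (h : n * x = (m + 1) * y) :
    leftover m n x y = x := by
  have hm1 : (0 : ℝ) < m + 1 := by positivity
  obtain ⟨u, rfl⟩ : ∃ u, x = (m + 1) * u := ⟨x / (m + 1), by field_simp⟩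
  obtain rfl : y = n * u := mul_left_cancel₀ hm1.ne' (by linarith)
  rw [leftover_of_ge m n hx (by linarith), reserve_boundary n m (nonneg_of_mul_nonneg_right hx hm1)]
  ring

end SeqAuction

/-! ### One round of the auction, and one-sided games -/

namespace SeqAuction

variable (v : Bool → ℝ)

theorem utility_zero (i : Bool) (x y : ℝ) : utility v 0 i x y = x := rfl

theorem utility_succ_of_lt (k : ℕ) (i : Bool) {x y : ℝ}
    (h : criticalPrice v (utility v k) (!i) y x < criticalPrice v (utility v k) i x y) :
    utility v (k + 1) i x y
      = v i + utility v k i (x - criticalPrice v (utility v k) (!i) y x) y := by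
  simp [utility, roundPayoff, Bid.Beats, canonicalBid, winningUtility, h, h.not_gt, h.le]

theorem utility_succ_of_gt (k : ℕ) (i : Bool) {x y : ℝ}
    (h : criticalPrice v (utility v k) i x y < criticalPrice v (utility v k) (!i) y x) :
    utility v (k + 1) i x y
      = utility v k i x (max (y - criticalPrice v (utility v k) i x y) 0) := by
  simp [utility, roundPayoff, Bid.Beats, canonicalBid, losingUtility, h, h.not_gt, h.le]

theorem utility_succ_of_eq (k : ℕ) (i : Bool) {x y : ℝ}
    (h : criticalPrice v (utility v k) (!i) y x = criticalPrice v (utility v k) i x y) :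
    utility v (k + 1) i x y
      = (v i + utility v k i (x - criticalPrice v (utility v k) (!i) y x) y
        + utility v k i x (max (y - criticalPrice v (utility v k) (!i) y x) 0)) / 2 := by
  simp [utility, roundPayoff, Bid.Beats, canonicalBid, winningUtility, losingUtility, h]

variable (U : Bool → ℝ → ℝ → ℝ)

theorem le_criticalPrice_of_mem (i : Bool) {x y p : ℝ} (h0 : 0 ≤ p) (hx : p ≤ x)
    (h : U i x (max (y - p) 0) < v i + U i (x - p) y) : p ≤ criticalPrice v U i x y :=
  le_csSup ⟨x, fun _ hq => hq.2.1⟩ ⟨h0, hx, h⟩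

theorem le_criticalPrice (i : Bool) {x y c : ℝ}
    (h : ∀ w < c, ∃ p, w < p ∧ 0 ≤ p ∧ p ≤ x ∧ U i x (max (y - p) 0) < v i + U i (x - p) y) :
    c ≤ criticalPrice v U i x y := by
  refine le_of_forall_lt fun w hw => ?_
  obtain ⟨p, h1, h2, h3, h4⟩ := h w hw
  exact h1.trans_le (le_criticalPrice_of_mem v U i h2 h3 h4)

theorem criticalPrice_eq_of_le (i : Bool) {x y c : ℝ}
    (hlow : ∀ w < c, ∃ p, w < p ∧ 0 ≤ p ∧ p ≤ x ∧ U i x (max (y - p) 0) < v i + U i (x - p) y)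
    (hhigh : ∀ p, c < p → p ≤ x → v i + U i (x - p) y ≤ U i x (max (y - p) 0)) :
    criticalPrice v U i x y = c := by
  refine csSup_eq_of_forall_le_of_forall_lt_exists_gt ?_ ?_ ?_
  · obtain ⟨p, -, h2, h3, h4⟩ := hlow (c - 1) (by linarith)
    exact ⟨p, h2, h3, h4⟩
  · rintro p ⟨-, h2, h3⟩
    by_contra! h
    exact (hhigh p h h2).not_gt h3
  · intro w hw
    obtain ⟨p, h1, h2, h3, h4⟩ := hlow w hw
    exact ⟨p, ⟨h2, h3, h4⟩, h1⟩

/-- If one agent can afford to outbid the other one's budget in every round, she wins all items. -/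
theorem utility_of_rich (k : ℕ) (i : Bool) {x y : ℝ} (hy : 0 ≤ y) (h : k * y < x) (hvx : x < v i)
    (hvy : y < v (!i)) :
    utility v k i x y = k * v i + x - k * y ∧ utility v k (!i) y x = y := by
  induction k generalizing x y with
  | zero => simp [utility_zero]
  | succ k ih =>
    have hk : (0 : ℝ) ≤ k := k.cast_nonneg
    push_cast at h ⊢
    have hky : 0 ≤ k * y := mul_nonneg hk hy
    have hother : criticalPrice v (utility v k) (!i) y x = y := by
      refine criticalPrice_eq_of_le v _ (!i) (fun w hw => ⟨y, hw, hy, le_rfl, ?_⟩)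
        (fun p h1 h2 => absurd h1 h2.not_gt)
      rw [max_eq_left (by linarith), (ih hy (by linarith) (by linarith) hvy).2, sub_self,
        (ih le_rfl (by linarith) hvx (by linarith)).2]
      linarith
    -- A win at such a `p` still leaves more than `k * y`, so the richer agent's critical price
    -- exceeds `y`.
    obtain ⟨p, hp1, hp2⟩ := exists_between (by linarith : y < x - k * y)
    have hown : p ≤ criticalPrice v (utility v k) i x y := by
      refine le_criticalPrice_of_mem v _ i (by linarith) (by linarith) ?_
      rw [max_eq_right (by linarith), (ih le_rfl (by linarith) hvx (by linarith)).1,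
        (ih hy (by linarith) (by linarith) hvy).1]
      linarith
    constructor
    · rw [utility_succ_of_lt v k i (by linarith), hother, (ih hy (by linarith) (by linarith) hvy).1]
      ring
    · rw [utility_succ_of_gt v k (!i) (by rw [Bool.not_not]; linarith), hother,
        max_eq_left (by linarith), (ih hy (by linarith) (by linarith) hvy).2]

theorem utility_zero_right (k : ℕ) (i : Bool) {x : ℝ} (hx : 0 < x) (hvx : x < v i)
    (hv : 0 < v (!i)) : utility v k i x 0 = k * v i + x := by
  rw [(utility_of_rich v k i le_rfl (by linarith) hvx hv).1]
  ring

theorem utility_zero_left (k : ℕ) (i : Bool) {y : ℝ} (hy : 0 < y) (hv : 0 < v i)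
    (hvy : y < v (!i)) : utility v k i 0 y = 0 := by
  have := (utility_of_rich v k (!i) (x := y) le_rfl (by linarith) hvy (by rwa [Bool.not_not])).2
  rwa [Bool.not_not] at this

end SeqAuction

/-! ### Staircase bounds, and the first round on a wall -/

namespace SeqAuction

variable (v : Bool → ℝ)

/-- Shape of the utility of `k` items: the formula between two jumps, and bounds at the jumps. -/
structure UtilityShape (k : ℕ) : Prop where
  interior : ∀ (i : Bool) (m n : ℕ) (x y : ℝ), m + n = k → 0 < x → 0 < y →
    2 ^ k * x < v i → 2 ^ k * y < v (!i) → m * y < (n + 1) * x → n * x < (m + 1) * y →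
    utility v k i x y = m * v i + leftover m n x y
  le_jump : ∀ (i : Bool) (m n : ℕ) (x y : ℝ), m + 1 + n = k → 0 < x → 0 < y →
    2 ^ k * x < v i → 2 ^ k * y < v (!i) → (m + 1) * y = (n + 1) * x →
    m * v i + v i / 2 ^ k ≤ utility v k i x y
  jump_le : ∀ (i : Bool) (m n : ℕ) (x y : ℝ), m + 1 + n = k → 0 < x → 0 < y →
    2 ^ k * x < v i → 2 ^ k * y < v (!i) → (m + 1) * y = (n + 1) * x →
    utility v k i x y ≤ (m + 1) * v i

theorem lt_of_two_pow_mul_lt {k : ℕ} {x a : ℝ} (hx : 0 ≤ x) (h : 2 ^ k * x < a) : x < a :=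
  (le_mul_of_one_le_left hx (one_le_pow₀ one_le_two)).trans_lt h

theorem two_pow_mul_lt_of_le {k : ℕ} {x x' a : ℝ} (hx : 0 ≤ x) (hxx : x' ≤ x)
    (h : 2 ^ (k + 1) * x < a) : 2 ^ k * x' < a := by
  refine lt_of_le_of_lt ?_ h
  have h1 : (2 : ℝ) ^ k * x' ≤ 2 ^ k * x := by gcongr
  have h2 : 0 ≤ (2 : ℝ) ^ k * x := by positivity
  rw [pow_succ]
  linarith

variable {v} {k : ℕ}

/-- Above the lower wall of cell $(m,n)$ the point lies in that cell, on its upper wall, or beyond.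
Induction on `n` moves through the higher cells, where the bound only improves. -/
theorem UtilityShape.lt_utility (H : UtilityShape v k) (i : Bool) (m n : ℕ)
    {x y : ℝ} (hmn : m + n = k) (hx : 0 < x) (hy : 0 ≤ y)
    (hvx : 2 ^ k * x < v i) (hvy : 2 ^ k * y < v (!i)) (h : m * y < (n + 1) * x) :
    m * v i < utility v k i x y := by
  have hxv := lt_of_two_pow_mul_lt hx.le hvx
  rcases hy.eq_or_lt with rfl | hy
  · rw [utility_zero_right v k i hx hxv (by simpa using hvy)]
    have : (m : ℝ) ≤ k := by exact_mod_cast (by omega : m ≤ k)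
    nlinarith
  induction n generalizing m with
  | zero =>
    rw [H.interior i m 0 x y hmn hx hy hvx hvy
      h (by simp only [Nat.cast_zero]; nlinarith [m.cast_nonneg (α := ℝ)])]
    linarith [leftover_pos m 0 hx hy.le h]
  | succ n ihn =>
    have hr := ihn (m + 1) (by omega)
    push_cast at hr h
    rcases lt_trichotomy ((n + 1) * x) ((m + 1) * y) with h1 | h1 | h1
    · rw [H.interior i m (n + 1) x y hmn hx hy hvx hvy (by push_cast; linarith)
        (by push_cast; linarith)]
      linarith [leftover_pos m (n + 1) hx hy.le (by push_cast; linarith)]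
    · have h2 := H.le_jump i m n x y (by omega) hx hy hvx hvy h1.symm
      have : 0 < v i / 2 ^ k := div_pos (hx.trans hxv) (by positivity)
      linarith
    · linarith [hr h1]

theorem UtilityShape.utility_le (H : UtilityShape v k) (i : Bool) (m n : ℕ)
    {x y : ℝ} (hmn : m + n = k) (hx : 0 ≤ x) (hy : 0 < y)
    (hvx : 2 ^ k * x < v i) (hvy : 2 ^ k * y < v (!i)) (h : n * x < (m + 1) * y) :
    utility v k i x y ≤ m * v i + x := by
  have hxv := lt_of_two_pow_mul_lt hx hvx
  rcases hx.eq_or_lt with rfl | hx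
  · rw [utility_zero_left v k i hy hxv (lt_of_two_pow_mul_lt hy.le hvy)]
    have := mul_nonneg (m.cast_nonneg (α := ℝ)) hxv.le
    linarith
  induction m generalizing n with
  | zero =>
    rw [H.interior i 0 n x y hmn hx hy hvx hvy
      (by simp only [Nat.cast_zero]; nlinarith [n.cast_nonneg (α := ℝ)]) h]
    linarith [leftover_le 0 n hx.le hy h]
  | succ m ihm =>
    have hr := ihm (n + 1) (by omega)
    push_cast at hr h ⊢
    rcases lt_trichotomy ((m + 1) * y) ((n + 1) * x) with h1 | h1 | h1
    · rw [H.interior i (m + 1) n x y hmn hx hy hvx hvy (by push_cast; linarith)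
        (by push_cast; linarith)]
      push_cast
      linarith [leftover_le (m + 1) n hx.le hy (by push_cast; linarith)]
    · linarith [H.jump_le i m n x y (by omega) hx hy hvx hvy h1]
    · linarith [hr h1]

/-- On the wall itself the surplus `v i / 2 ^ k` left by the coin tosses must beat the budget `x`;
this is where the factor `2 ^ k` of the hypothesis acts. -/
theorem UtilityShape.add_lt_utility (H : UtilityShape v k) (i : Bool) (m n : ℕ)
    {x y : ℝ} (hmn : m + 1 + n = k) (hx : 0 < x)
    (hy : 0 ≤ y) (hvx : 2 ^ k * x < v i) (hvy : 2 ^ k * y < v (!i))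
    (h : (m + 1) * y ≤ (n + 1) * x) : m * v i + x < utility v k i x y := by
  have hxv := lt_of_two_pow_mul_lt hx.le hvx
  rcases h.eq_or_lt with h | h
  · have hy' : 0 < y := pos_of_mul_pos_right (h ▸ by positivity) (by positivity : (0 : ℝ) ≤ m + 1)
    have h1 := H.le_jump i m n x y hmn hx hy' hvx hvy h
    have h2 : x < v i / 2 ^ k := (lt_div_iff₀' (by positivity)).mpr hvx
    linarith
  · have := H.lt_utility i (m + 1) n hmn hx hy hvx hvy (by push_cast; linarith)
    push_cast at this
    linarith

theorem UtilityShape.utility_le_mul (H : UtilityShape v k) (i : Bool) (m n : ℕ)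
    {x y : ℝ} (hmn : m + 1 + n = k) (hx : 0 ≤ x)
    (hy : 0 < y) (hvx : 2 ^ k * x < v i) (hvy : 2 ^ k * y < v (!i))
    (h : (n + 1) * x ≤ (m + 1) * y) : utility v k i x y ≤ (m + 1) * v i := by
  have hxv := lt_of_two_pow_mul_lt hx hvx
  rcases h.eq_or_lt with h | h
  · have hx' : 0 < x := pos_of_mul_pos_right (h ▸ by positivity) (by positivity : (0 : ℝ) ≤ n + 1)
    exact H.jump_le i m n x y hmn hx' hy hvx hvy h.symm
  · have := H.utility_le i m (n + 1) (by omega) hx hy hvx hvy (by push_cast; linarith)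
    linarith

/-- A price of exactly `q`, paid by either agent, leads to a wall or to a zero budget. Below `q` a
loss leaves at most `m * v i + x` while a win is worth more than `(m + 1) * v i`; above `q` the
winner drops a step, and the preference is reversed. -/
theorem UtilityShape.criticalPrice_jump (H : UtilityShape v k) (i : Bool) (m n : ℕ)
    {q : ℝ} (hmn : m + n = k) (hq : 0 < q)
    (hvx : 2 ^ (k + 1) * ((m + 1) * q) < v i) (hvy : 2 ^ (k + 1) * ((n + 1) * q) < v (!i)) :
    criticalPrice v (utility v k) i ((m + 1) * q) ((n + 1) * q) = q := by
  have hx : 0 < (m + 1) * q := by positivity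
  have hy : 0 < (n + 1) * q := by positivity
  have hmq : 0 ≤ m * q := by positivity
  have hnq : 0 ≤ n * q := by positivity
  have hm1 : (0 : ℝ) < m + 1 := by positivity
  have hn1 : (0 : ℝ) < n + 1 := by positivity
  have hxv := lt_of_two_pow_mul_lt hx.le hvx
  refine criticalPrice_eq_of_le v _ i (fun w hw => ?_) (fun p h1 h2 => ?_)
  · obtain ⟨p, h1, h2⟩ := exists_between (max_lt hw hq)
    obtain ⟨h1, h3⟩ := max_lt_iff.mp h1
    refine ⟨p, h1, h3.le, by linarith, ?_⟩
    rw [max_eq_left (by linarith)]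
    have h4 := H.lt_utility i m n (x := (m + 1) * q - p) hmn (by linarith) hy.le
      (two_pow_mul_lt_of_le hx.le (by linarith) hvx) (two_pow_mul_lt_of_le hy.le le_rfl hvy)
      (by nlinarith)
    have h5 := H.utility_le i m n (y := (n + 1) * q - p) hmn hx.le (by linarith)
      (two_pow_mul_lt_of_le hx.le le_rfl hvx) (two_pow_mul_lt_of_le hy.le (by linarith) hvy)
      (by nlinarith)
    linarith
  · obtain ⟨m, rfl⟩ : ∃ m', m = m' + 1 := by
      refine Nat.exists_eq_succ_of_ne_zero ?_
      rintro rfl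
      simp only [Nat.cast_zero] at h2
      linarith
    push_cast at *
    have h3 := H.utility_le i m (n + 1) (x := (m + 1 + 1) * q - p) (by omega) (by linarith) hy
      (two_pow_mul_lt_of_le hx.le (by linarith) hvx) (two_pow_mul_lt_of_le hy.le le_rfl hvy)
      (by push_cast; nlinarith)
    rcases le_or_gt ((n + 1) * q) p with h4 | h4
    · rw [max_eq_right (by linarith), utility_zero_right v k i hx hxv
        (hy.trans (lt_of_two_pow_mul_lt hy.le hvy))]
      have : (m : ℝ) + 1 ≤ k := by exact_mod_cast (by omega : m + 1 ≤ k)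
      nlinarith
    · obtain ⟨n, rfl⟩ : ∃ n', n = n' + 1 := by
        refine Nat.exists_eq_succ_of_ne_zero ?_
        rintro rfl
        simp only [Nat.cast_zero] at h4
        linarith
      push_cast at *
      have h5 := H.lt_utility i (m + 1 + 1) n (y := (n + 1 + 1) * q - p) (by omega) hx (by linarith)
        (two_pow_mul_lt_of_le hx.le le_rfl hvx) (two_pow_mul_lt_of_le hy.le (by linarith) hvy)
        (by push_cast; nlinarith)
      rw [max_eq_left (by linarith)]
      push_cast at h5
      linarith

theorem UtilityShape.utility_jump (H : UtilityShape v k) (i : Bool) (m n : ℕ)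
    {q : ℝ} (hmn : m + n = k) (hq : 0 < q)
    (hvx : 2 ^ (k + 1) * ((m + 1) * q) < v i) (hvy : 2 ^ (k + 1) * ((n + 1) * q) < v (!i)) :
    utility v (k + 1) i ((m + 1) * q) ((n + 1) * q)
      = (v i + utility v k i (m * q) ((n + 1) * q) + utility v k i ((m + 1) * q) (n * q)) / 2 := by
  have h1 := H.criticalPrice_jump i m n hmn hq hvx hvy
  have h2 := H.criticalPrice_jump (!i) n m (by omega) hq hvy (by rwa [Bool.not_not])
  rw [utility_succ_of_eq v k i (by rw [h1, h2]), h2, max_eq_left]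
  · ring_nf
  · have : 0 ≤ n * q := by positivity
    linarith

theorem UtilityShape.jump_bounds_succ (H : UtilityShape v k) (i : Bool) (m n : ℕ)
    {q : ℝ} (hmn : m + n = k) (hq : 0 < q)
    (hvx : 2 ^ (k + 1) * ((m + 1) * q) < v i) (hvy : 2 ^ (k + 1) * ((n + 1) * q) < v (!i)) :
    m * v i + v i / 2 ^ (k + 1) ≤ utility v (k + 1) i ((m + 1) * q) ((n + 1) * q) ∧
      utility v (k + 1) i ((m + 1) * q) ((n + 1) * q) ≤ (m + 1) * v i := by
  have hx : 0 < (m + 1) * q := by positivity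
  have hy : 0 < (n + 1) * q := by positivity
  have hxv := lt_of_two_pow_mul_lt hx.le hvx
  have hyv := lt_of_two_pow_mul_lt hy.le hvy
  have hv : 0 < v i := hx.trans hxv
  have hpow : v i / 2 ^ (k + 1) = v i / 2 ^ k / 2 := by rw [pow_succ]; field_simp
  have hpow1 : v i / 2 ^ k ≤ v i := div_le_self hv.le (one_le_pow₀ one_le_two)
  have hpow0 : 0 < v i / 2 ^ k := by positivity
  -- The `if` separates the zero budgets, to which the wall bounds do not apply. At least one of the
  -- two continuations contributes `v i / 2 ^ k`, and averaging halves it.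
  have hA : utility v k i (m * q) ((n + 1) * q) ≤ m * v i ∧
      (m * v i - v i + (if m = 0 then v i else v i / 2 ^ k)
        ≤ utility v k i (m * q) ((n + 1) * q)) := by
    cases m with
    | zero =>
      simp only [Nat.cast_zero, zero_mul, if_true]
      rw [utility_zero_left v k i hy hv hyv]
      constructor <;> linarith
    | succ m =>
      push_cast at *
      have hmq : 0 < (m + 1) * q := by positivity
      have h1 := two_pow_mul_lt_of_le hx.le (by linarith : (m + 1) * q ≤ _) hvx
      have h2 := two_pow_mul_lt_of_le hy.le le_rfl hvy
      have h3 := H.le_jump i m n _ _ hmn hmq hy h1 h2 (by ring)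
      have h4 := H.jump_le i m n _ _ hmn hmq hy h1 h2 (by ring)
      constructor <;> linarith
  have hB : utility v k i ((m + 1) * q) (n * q) ≤ (m + 1) * v i ∧
      (m * v i + (if n = 0 then 0 else v i / 2 ^ k)
        ≤ utility v k i ((m + 1) * q) (n * q)) := by
    cases n with
    | zero =>
      simp only [Nat.cast_zero, zero_mul, if_true]
      rw [utility_zero_right v k i hx hxv (hy.trans hyv)]
      obtain rfl : m = k := hmn
      constructor <;> linarith
    | succ n =>
      push_cast at *
      have hnq : 0 < (n + 1) * q := by positivity
      have h1 := two_pow_mul_lt_of_le hy.le (by linarith : (n + 1) * q ≤ _) hvy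
      have h2 := two_pow_mul_lt_of_le hx.le le_rfl hvx
      have h3 := H.le_jump i m n _ _ (by omega) hx hnq h2 h1 (by ring)
      have h4 := H.jump_le i m n _ _ (by omega) hx hnq h2 h1 (by ring)
      constructor <;> linarith
  rw [H.utility_jump i m n hmn hq hvx hvy, hpow]
  obtain ⟨hA1, hA2⟩ := hA
  obtain ⟨hB1, hB2⟩ := hB
  refine ⟨?_, by linarith⟩
  by_cases hm : m = 0
  · rw [if_pos hm] at hA2
    split_ifs at hB2 with hn
    · linarith
    · linarith
  · rw [if_neg hm] at hA2
    split_ifs at hB2 with hn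
    · linarith
    · linarith

end SeqAuction

/-! ### The first round inside a cell -/

namespace SeqAuction

variable {v : Bool → ℝ} {k : ℕ}

set_option maxHeartbeats 1000000 in
/-- First round of a game in which the poorer agent, with budget `x`, gets `m + 1` items. -/
theorem UtilityShape.utility_succ_of_poor (H : UtilityShape v k) (i : Bool) (m n : ℕ)
    {x y : ℝ} (hmn : m + n + 1 = k) (hx : 0 < x)
    (hy : 0 < y) (hvx : 2 ^ (k + 1) * x < v i) (hvy : 2 ^ (k + 1) * y < v (!i))
    (hlow : (m + 1) * y < (n + 2) * x) (hxy : (n + 2) * x ≤ (m + 2) * y) :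
    utility v (k + 1) i x y = (m + 1) * v i + reserve (m + 1) (n + 1) x y ∧
      utility v (k + 1) (!i) y x
        = (n + 1) * v (!i) + (y - (n + 1) * reserve (m + 1) (n + 1) x y) := by
  have hn : (0 : ℝ) ≤ n := n.cast_nonneg
  have hm : (0 : ℝ) ≤ m := m.cast_nonneg
  have hi : v (!!i) = v i := by rw [Bool.not_not]
  have hxv := lt_of_two_pow_mul_lt hx.le hvx
  have hyv := lt_of_two_pow_mul_lt hy.le hvy
  have hvx' : ∀ {x'}, x' ≤ x → 2 ^ k * x' < v i := fun h => two_pow_mul_lt_of_le hx.le h hvx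
  have hvy' : ∀ {y'}, y' ≤ y → 2 ^ k * y' < v (!i) := fun h => two_pow_mul_lt_of_le hy.le h hvy
  have hpos := reserve_pos (m + 1) (n + 1) hx hy.le (by push_cast; linarith)
    (by push_cast; linarith)
  have hlose := reserve_lose_le m n hx hy.le hlow hxy
  have hge := firstPrice_ge m n hx.le hy.le hxy
  have hle := firstPrice_le m n hx.le hy.le hxy
  have hs := reserve_succ m n x y
  have hb := le_firstPrice m n x y
  have hsle := reserve_le m n x y
  have hseq := reserve_eq m n x y
  set p := firstPrice m n x y with hp
  set s := reserve (m + 1) (n + 1) x y with hs'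
  set t := reserve (m + 1) n x (y - p) with ht
  have hp0 : 0 < p := pos_of_mul_pos_right (by linarith : 0 < (n + 2) * p) (by linarith)
  have hup := lt_of_reserve_pos m (n + 1) hy.le (hs ▸ hpos)
  push_cast at hup
  -- `hc` and `ha` put the budgets after a win of `i` at `p` strictly inside cell $(m,n+1)$. `hd`
  -- and `hb` put those after a loss in cell $(m+1,n)$, possibly on its lower wall.
  have hc : m * y < (n + 2) * (x - p) := by linarith
  have hd : n * x < (m + 2) * (y - p) := by linarith
  have hpx : p < x := by
    have := pos_of_mul_pos_right ((mul_nonneg hm hy.le).trans_lt hc) (by linarith : 0 ≤ (n : ℝ) + 2)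
    linarith
  have hpy : p < y := by
    have := pos_of_mul_pos_right ((mul_nonneg hn hx.le).trans_lt hd) (by linarith : 0 ≤ (m : ℝ) + 2)
    linarith
  have ha : (n + 1) * x - (m + 1) * y < (n + 1) * p := by
    have : (n + 2) * ((n + 1) * x - (m + 1) * y) < (n + 2) * ((n + 1) * p) := by nlinarith
    exact lt_of_mul_lt_mul_left this (by linarith)
  have hWin : ∀ {r}, 0 ≤ r → (n + 1) * x - (m + 1) * y < (n + 1) * r → m * y < (n + 2) * (x - r) →
      utility v k i (x - r) y = m * v i + leftover m (n + 1) (x - r) y := by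
    intro r h0 h1 h2
    have h3 := pos_of_mul_pos_right ((mul_nonneg hm hy.le).trans_lt h2)
      (by linarith : 0 ≤ (n : ℝ) + 2)
    exact H.interior i m (n + 1) _ _ (by omega) h3 hy (hvx' (by linarith)) (hvy' le_rfl)
      (by push_cast; linarith) (by push_cast; linarith)
  have hLose : ∀ {r}, 0 ≤ r → (m + 1) * y - (n + 1) * x < (m + 1) * r → n * x < (m + 2) * (y - r) →
      utility v k i x (max (y - r) 0) = (m + 1) * v i + leftover (m + 1) n x (y - r) := by
    intro r h0 h1 h2
    have h3 := pos_of_mul_pos_right ((mul_nonneg hn hx.le).trans_lt h2)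
      (by linarith : 0 ≤ (m : ℝ) + 2)
    rw [max_eq_left h3.le, H.interior i (m + 1) n _ _ (by omega) hx h3 (hvx' le_rfl)
      (hvy' (by linarith)) (by push_cast; linarith) (by push_cast; linarith)]
    push_cast
    rfl
  have hWin' : ∀ {r}, 0 ≤ r → (m + 1) * y - (n + 1) * x < (m + 1) * r → n * x < (m + 2) * (y - r) →
      utility v k (!i) (y - r) x = n * v (!i) + leftover n (m + 1) (y - r) x := by
    intro r h0 h1 h2
    have h3 := pos_of_mul_pos_right ((mul_nonneg hn hx.le).trans_lt h2)
      (by linarith : 0 ≤ (m : ℝ) + 2)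
    exact H.interior (!i) n (m + 1) _ _ (by omega) h3 hx (hvy' (by linarith))
      (hi ▸ hvx' le_rfl) (by push_cast; linarith) (by push_cast; linarith)
  have hLose' : ∀ {r}, 0 ≤ r → (n + 1) * x - (m + 1) * y < (n + 1) * r → m * y < (n + 2) * (x - r) →
      utility v k (!i) y (max (x - r) 0) = (n + 1) * v (!i) + leftover (n + 1) m y (x - r) := by
    intro r h0 h1 h2
    have h3 := pos_of_mul_pos_right ((mul_nonneg hm hy.le).trans_lt h2)
      (by linarith : 0 ≤ (n : ℝ) + 2)
    rw [max_eq_left h3.le, H.interior (!i) (n + 1) m _ _ (by omega) hy h3 (hvy' le_rfl)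
      (hi ▸ hvx' (by linarith)) (by push_cast; linarith) (by push_cast; linarith)]
    push_cast
    rfl
  have hwin : leftover m (n + 1) (x - p) y = s := by
    rw [hs, leftover_of_le _ _ (by push_cast; linarith)]
  have hlos : leftover (m + 1) n x (y - p) = t := leftover_of_le _ _ (by push_cast; linarith)
  have hwin' : leftover n (m + 1) (y - p) x = y - p - n * t :=
    leftover_of_ge _ _ (by linarith) (by push_cast; linarith)
  have hlos' : leftover (n + 1) m y (x - p) = y - (n + 1) * s := by
    rw [hs, leftover_of_ge _ _ hy.le (by push_cast; linarith)]
    push_cast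
    rfl
  have hleft : (m + 1) * y - (n + 1) * x < (m + 1) * p → ∀ w < p, ∃ r, w < r ∧ 0 ≤ r ∧ r < p ∧
      (m + 1) * y - (n + 1) * x < (m + 1) * r ∧ (n + 1) * x - (m + 1) * y < (n + 1) * r := by
    intro hb' w hw
    have hb'' : ((m + 1) * y - (n + 1) * x) / (m + 1) < p := (div_lt_iff₀' (by linarith)).mpr hb'
    have ha'' : ((n + 1) * x - (m + 1) * y) / (n + 1) < p := (div_lt_iff₀' (by linarith)).mpr ha
    obtain ⟨r, h1, h2⟩ := exists_between (max_lt (max_lt hw hp0) (max_lt hb'' ha''))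
    obtain ⟨h3, h4⟩ := max_lt_iff.mp h1
    obtain ⟨h5, h6⟩ := max_lt_iff.mp h3
    obtain ⟨h7, h8⟩ := max_lt_iff.mp h4
    exact ⟨r, h5, h6.le, h2, (div_lt_iff₀' (by linarith)).mp h7,
      (div_lt_iff₀' (by linarith)).mp h8⟩
  -- Below `p` the richer agent prefers winning: if `p` is the wall price a cheaper win gains an
  -- item, otherwise balance at `p` and monotonicity decide. Above `p` monotonicity works while both
  -- continuations stay in their cells; beyond the walls the staircase bounds decide.
  have hother : criticalPrice v (utility v k) (!i) y x = p := by
    refine criticalPrice_eq_of_le v _ (!i) (fun w hw => ?_) (fun r h1 h2 => ?_)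
    · rcases hb.eq_or_lt with h | h
      · obtain ⟨r, h1, h2⟩ := exists_between (max_lt hw hp0)
        obtain ⟨h3, h4⟩ := max_lt_iff.mp h1
        refine ⟨r, h3, h4.le, by linarith, ?_⟩
        have h5 : (m + 1) * r < (m + 1) * p := by gcongr
        have h6 := H.lt_utility (!i) (n + 1) m (x := y - r) (y := x) (by omega) (by linarith) hx.le
          (hvy' (by linarith)) (hi ▸ hvx' le_rfl) (by push_cast; linarith)
        have h7 := H.utility_le (!i) (n + 1) m (x := y) (y := x - r) (by omega) hy.le
          (by linarith) (hvy' le_rfl) (hi ▸ hvx' (by linarith)) (by push_cast; nlinarith)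
        rw [max_eq_left (by linarith)]
        push_cast at h6 h7
        linarith
      · obtain ⟨r, h1, h2, h3, h4, h5⟩ := hleft h w hw
        refine ⟨r, h1, h2, by linarith, ?_⟩
        rw [hWin' h2 h4 (hd.trans (by gcongr)), hLose' h2 h5 (hc.trans (by gcongr))]
        have h6 := leftover_lt n (m + 1) (y := x) (by linarith) hx.le
          (by linarith : y - p < y - r)
        have h7 := leftover_anti (n + 1) m hy.le (by linarith : x - p ≤ x - r)
        linarith [hseq h]
    · have hbr : (m + 1) * y - (n + 1) * x < (m + 1) * r := hb.trans_lt (by gcongr)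
      have har : (n + 1) * x - (m + 1) * y < (n + 1) * r := ha.trans (by gcongr)
      rcases le_or_gt ((n + 2) * (x - r)) (m * y) with h3 | h3
      · have h4 := H.utility_le (!i) n (m + 1) (x := y - r) (y := x) (by omega) (by linarith) hx
          (hvy' (by linarith)) (hi ▸ hvx' le_rfl) (by push_cast; linarith)
        rcases le_or_gt x r with h5 | h5
        · rw [max_eq_right (by linarith), utility_zero_right v k (!i) hy hyv (by rw [hi]; linarith)]
          have : (n : ℝ) + 1 ≤ k := by exact_mod_cast (by omega : n + 1 ≤ k)
          nlinarith
        · obtain ⟨m, rfl⟩ : ∃ m', m = m' + 1 := by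
            refine Nat.exists_eq_succ_of_ne_zero ?_
            rintro rfl
            simp only [Nat.cast_zero, zero_mul] at h3
            exact (mul_pos (by linarith : (0 : ℝ) < n + 2) (sub_pos.mpr h5)).not_ge h3
          have h6 := H.add_lt_utility (!i) (n + 1) m (x := y) (y := x - r) (by omega) hy
            (by linarith) (hvy' le_rfl) (hi ▸ hvx' (by linarith)) (by push_cast at h3 ⊢; linarith)
          rw [max_eq_left (by linarith)]
          push_cast at h6
          linarith
      · have hxr := pos_of_mul_pos_right ((mul_nonneg hm hy.le).trans_lt h3)
          (by linarith : 0 ≤ (n : ℝ) + 2)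
        rcases le_or_gt ((m + 2) * (y - r)) (n * x) with h4 | h4
        · have h5 : utility v k (!i) (y - r) x ≤ n * v (!i) := by
            cases n with
            | zero =>
              obtain rfl : y = r := by
                simp only [Nat.cast_zero, zero_mul] at h4
                have := nonpos_of_mul_nonpos_right h4 (by linarith : (0 : ℝ) < m + 2)
                linarith
              rw [sub_self, utility_zero_left v k (!i) hx (by linarith) (by rwa [hi])]
              simp
            | succ n =>
              have := H.utility_le_mul (!i) n (m + 1) (x := y - r) (y := x) (by omega)
                (by linarith) hx (hvy' (by linarith)) (hi ▸ hvx' le_rfl)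
                (by push_cast at h4 ⊢; linarith)
              push_cast
              exact this
          have h6 := H.lt_utility (!i) (n + 1) m (x := y) (y := x - r) (by omega) hy
            hxr.le (hvy' le_rfl) (hi ▸ hvx' (by linarith)) (by push_cast; linarith)
          rw [max_eq_left hxr.le]
          push_cast at h6
          linarith
        · rw [hWin' (by linarith) hbr h4, hLose' (by linarith) har h3]
          have h6 := leftover_lt n (m + 1) (y := x) (by linarith) hx.le
            (by linarith : y - r < y - p)
          have h7 := leftover_anti (n + 1) m hy.le (by linarith : x - r ≤ x - p)
          linarith
  have hown : p ≤ criticalPrice v (utility v k) i x y ∧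
      (p = criticalPrice v (utility v k) i x y →
        t = s ∧ (m + 1) * y - (n + 1) * x < (m + 1) * p) := by
    -- If winning at `p` is strictly better, it remains so slightly above `p` by continuity, and the
    -- critical price exceeds `p`. In the case of equality `p` is not the wall price, since there
    -- losing leaves `0 < s`.
    rcases hlose.lt_or_eq with h | h
    · have hcont : ContinuousAt (fun r => leftover m (n + 1) (x - r) y
          - leftover (m + 1) n x (y - r)) p := by
        refine ContinuousAt.sub ?_ ?_
        · exact (continuousAt_leftover m (n + 1) (y := y) (sub_pos.mpr hpx).le).comp
            (f := fun r => (x - r, y)) (by fun_prop)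
        · exact (continuousAt_leftover (m + 1) n (y := y - p) hx.le).comp
            (f := fun r => (x, y - r)) (by fun_prop)
      have hcc : Continuous fun r => ((n : ℝ) + 2) * (x - r) := by fun_prop
      have hdd : Continuous fun r => ((m : ℝ) + 2) * (y - r) := by fun_prop
      have hev : ∀ᶠ r in 𝓝 p, 0 < leftover m (n + 1) (x - r) y - leftover (m + 1) n x (y - r) ∧
          m * y < (n + 2) * (x - r) ∧ n * x < (m + 2) * (y - r) ∧ r < x := by
        refine (hcont.eventually (lt_mem_nhds ?_)).and ((hcc.continuousAt.eventually
          (lt_mem_nhds hc)).and ((hdd.continuousAt.eventually (lt_mem_nhds hd)).and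
          (gt_mem_nhds hpx)))
        simp only [hwin, hlos]
        linarith
      obtain ⟨r, ⟨h1, h2, h3, h4⟩, h5⟩ :=
        ((hev.filter_mono nhdsWithin_le_nhds).and (self_mem_nhdsWithin (s := Set.Ioi p))).exists
      have h5 : p < r := h5
      have h6 : r ≤ criticalPrice v (utility v k) i x y := by
        refine le_criticalPrice_of_mem v _ i (by linarith) h4.le ?_
        rw [hWin (by linarith) (ha.trans (by gcongr)) h2,
          hLose (by linarith) (hb.trans_lt (by gcongr)) h3]
        linarith
      exact ⟨by linarith, fun h7 => by linarith⟩
    · have hb' : (m + 1) * y - (n + 1) * x < (m + 1) * p := by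
        refine lt_of_le_of_ne hb fun h1 => ?_
        have h2 := leftover_lower (m + 1) n (x := x) (y := y - p) hx.le (by linarith)
          (by push_cast; linarith)
        linarith
      refine ⟨le_criticalPrice v _ i fun w hw => ?_, fun _ => ⟨h, hb'⟩⟩
      obtain ⟨r, h1, h2, h3, h4, h5⟩ := hleft hb' w hw
      refine ⟨r, h1, h2, by linarith, ?_⟩
      rw [hWin h2 h5 (hc.trans (by gcongr)), hLose h2 h4 (hd.trans (by gcongr))]
      have h6 := leftover_lt m (n + 1) (y := y) (by linarith) hy.le
        (by linarith : x - p < x - r)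
      have h7 := leftover_anti (m + 1) n hx.le (by linarith : y - p ≤ y - r)
      linarith
  have hW := hWin hp0.le ha hc
  have hL' := hLose' hp0.le ha hc
  rw [hwin] at hW
  rw [hlos'] at hL'
  -- With equal critical prices a coin decides, but `t = s` and the balance equation make both
  -- agents indifferent to its result.
  rcases hown.1.eq_or_lt with h | h
  · obtain ⟨h1, h2⟩ := hown.2 h
    have h3 := hseq h2
    have hL := hLose hp0.le h2 hd
    have hW' := hWin' hp0.le h2 hd
    rw [hlos] at hL
    rw [hwin'] at hW'
    rw [utility_succ_of_eq v k i (by rw [hother, ← h]),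
      utility_succ_of_eq v k (!i) (by rw [hother, Bool.not_not, ← h]), hother, Bool.not_not, ← h,
      hW, hL, hW', hL', h1]
    constructor
    · ring
    · rw [h1] at h3
      linarith
  · rw [utility_succ_of_lt v k i (by rwa [hother]),
      utility_succ_of_gt v k (!i) (by rwa [hother, Bool.not_not]), hother, hW, hL']
    constructor
    · ring
    · ring

theorem UtilityShape.interior_succ (H : UtilityShape v k) (i : Bool) (m n : ℕ)
    {x y : ℝ} (hmn : m + n = k + 1) (hx : 0 < x)
    (hy : 0 < y) (hvx : 2 ^ (k + 1) * x < v i) (hvy : 2 ^ (k + 1) * y < v (!i))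
    (hlow : m * y < (n + 1) * x) (hup : n * x < (m + 1) * y) :
    utility v (k + 1) i x y = m * v i + leftover m n x y := by
  have hxv := lt_of_two_pow_mul_lt hx.le hvx
  have hyv := lt_of_two_pow_mul_lt hy.le hvy
  cases m with
  | zero =>
    obtain rfl : n = k + 1 := by omega
    have h := (utility_of_rich v (k + 1) (!i) hx.le (by simpa using hup) hyv
      (by rwa [Bool.not_not])).2
    rw [Bool.not_not] at h
    simp [h, leftover, reserve_zero_left]
  | succ m =>
    cases n with
    | zero =>
      obtain rfl : m = k := by omega
      rw [(utility_of_rich v (m + 1) i hy.le (by simpa using hlow) hxv hyv).1]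
      simp only [leftover, reserve_zero_left, reserve_zero_right, ite_self]
      ring
    | succ n =>
      push_cast at hlow hup ⊢
      rcases le_total ((n + 2) * x) ((m + 2) * y) with h | h
      · rw [(H.utility_succ_of_poor i m n (by omega) hx hy hvx hvy (by linarith) h).1,
          leftover_of_le _ _ (by push_cast; linarith)]
      · have h1 := (H.utility_succ_of_poor (!i) n m (by omega) hy hx hvy
          (by rwa [Bool.not_not]) (by linarith) h).2
        rw [Bool.not_not] at h1
        rw [h1, leftover_of_ge _ _ hx.le (by push_cast; linarith)]
        push_cast
        rfl

theorem utilityShape (v : Bool → ℝ) (k : ℕ) : UtilityShape v k := by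
  induction k with
  | zero =>
    refine ⟨fun i m n x y hmn _ _ _ _ _ _ => ?_, fun i m n x y hmn => by omega,
      fun i m n x y hmn => by omega⟩
    obtain ⟨rfl, rfl⟩ : m = 0 ∧ n = 0 := by omega
    simp [utility_zero, leftover, reserve_zero_left]
  | succ k ih =>
    have jump : ∀ (i : Bool) (m n : ℕ) (x y : ℝ), m + 1 + n = k + 1 → 0 < x → 0 < y →
        2 ^ (k + 1) * x < v i → 2 ^ (k + 1) * y < v (!i) → (m + 1) * y = (n + 1) * x →
        m * v i + v i / 2 ^ (k + 1) ≤ utility v (k + 1) i x y ∧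
          utility v (k + 1) i x y ≤ (m + 1) * v i := by
      intro i m n x y hmn hx hy hvx hvy h
      have hm1 : (0 : ℝ) < m + 1 := by positivity
      obtain ⟨q, rfl⟩ : ∃ q, x = (m + 1) * q := ⟨x / (m + 1), by field_simp⟩
      obtain rfl : y = (n + 1) * q := mul_left_cancel₀ hm1.ne' (by linarith)
      exact ih.jump_bounds_succ i m n (by omega) (pos_of_mul_pos_right hx hm1.le) hvx hvy
    exact ⟨fun i m n x y hmn hx hy hvx hvy => ih.interior_succ i m n hmn hx hy hvx hvy,
      fun i m n x y hmn hx hy hvx hvy h => (jump i m n x y hmn hx hy hvx hvy h).1,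
      fun i m n x y hmn hx hy hvx hvy h => (jump i m n x y hmn hx hy hvx hvy h).2⟩

/-! ### Coin tosses and the value on a wall -/

/-- Number of outcomes of `N` coin tosses with at least `t` heads. -/
noncomputable def headCount (N : ℕ) (t : ℤ) : ℕ :=
  (Finset.univ.filter fun s : Fin N → Bool =>
    t ≤ ((Finset.univ.filter fun j => s j = true).card : ℤ)).card

/-- Pascal's rule, by conditioning on the first toss. -/
theorem headCount_succ (N : ℕ) (t : ℤ) :
    headCount (N + 1) t = headCount N t + headCount N (t - 1) := by
  have hcard (b : Bool) (s : Fin N → Bool) :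
      ((Finset.univ.filter fun j => (Fin.cons b s : Fin (N + 1) → Bool) j = true).card : ℤ)
        = (Finset.univ.filter fun j => s j = true).card + (if b = true then 1 else 0) := by
    rw [Fin.card_filter_univ_succ]
    cases b <;> simp
  unfold headCount
  rw [Finset.card_filter, ← (Fin.consEquiv fun _ => Bool).sum_comp, Fintype.sum_prod_type,
    Fintype.sum_bool, Finset.card_filter, Finset.card_filter, add_comm]
  simp only [Fin.consEquiv_apply, hcard, Bool.false_eq_true, if_true, if_false, add_zero,
    sub_le_iff_le_add]

theorem headCount_of_nonpos (N : ℕ) {t : ℤ} (h : t ≤ 0) : headCount N t = 2 ^ N := by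
  unfold headCount
  rw [Finset.filter_true_of_mem fun s _ => by omega]
  simp

theorem headCount_of_lt (N : ℕ) {t : ℤ} (h : N < t) : headCount N t = 0 := by
  unfold headCount
  rw [Finset.card_eq_zero, Finset.filter_eq_empty_iff]
  intro s _
  have := Finset.card_filter_le (Finset.univ : Finset (Fin N)) fun j => s j = true
  rw [Finset.card_univ, Fintype.card_fin] at this
  omega

theorem coinPhi_eq (m n : ℤ) (N : ℕ) (h : m + n + 1 = N) :
    coinPhi m n = headCount N (n + 1) / 2 ^ N := by
  obtain rfl : N = (m + n + 1).toNat := by omega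
  rfl

theorem coinPhi_rec (m n : ℤ) (h : 0 ≤ m + n) :
    coinPhi m n = (coinPhi (m - 1) n + coinPhi m (n - 1)) / 2 := by
  obtain ⟨N, hN⟩ := Int.eq_ofNat_of_zero_le h
  rw [coinPhi_eq m n (N + 1) (by push_cast; omega), coinPhi_eq (m - 1) n N (by omega),
    coinPhi_eq m (n - 1) N (by omega), headCount_succ, pow_succ,
    show n + 1 - 1 = n - 1 + 1 by ring]
  push_cast
  field_simp

theorem coinPhi_neg_left {m n : ℤ} (hm : m < 0) (h : 0 ≤ m + n + 1) : coinPhi m n = 0 := by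
  obtain ⟨N, hN⟩ := Int.eq_ofNat_of_zero_le h
  rw [coinPhi_eq m n N hN, headCount_of_lt N (by omega)]
  simp

theorem coinPhi_neg_right {m n : ℤ} (hn : n < 0) (h : 0 ≤ m + n + 1) : coinPhi m n = 1 := by
  obtain ⟨N, hN⟩ := Int.eq_ofNat_of_zero_le h
  rw [coinPhi_eq m n N hN, headCount_of_nonpos N (by omega)]
  simp

variable {v : Bool → ℝ}

/-- Expected utility at a jump. -/
theorem utility_at_jump (k : ℕ) (i : Bool) (m n : ℕ) {q : ℝ} (hmn : m + 1 + n = k) (hq : 0 < q)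
    (hvx : 2 ^ k * ((m + 1) * q) < v i) (hvy : 2 ^ k * ((n + 1) * q) < v (!i)) :
    utility v k i ((m + 1) * q) ((n + 1) * q)
      = m * v i + coinPhi n m * v i + coinPhi m n * ((m + 1) * q)
        - coinPhi (m - 1) (n + 1) * ((n + 1) * q) := by
  induction k generalizing m n with
  | zero => omega
  | succ k ih =>
    have hx : 0 < (m + 1) * q := by positivity
    have hy : 0 < (n + 1) * q := by positivity
    have hxv := lt_of_two_pow_mul_lt hx.le hvx
    have hyv := lt_of_two_pow_mul_lt hy.le hvy
    -- For `m = 0` the budget is exhausted; the values of `coinPhi` at negative indices make the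
    -- same formula valid there, and likewise for `n = 0` in `hlose`.
    have hwin : utility v k i (m * q) ((n + 1) * q)
        = (m - 1) * v i + coinPhi n (m - 1) * v i + coinPhi (m - 1) n * (m * q)
          - coinPhi (m - 2) (n + 1) * ((n + 1) * q) := by
      cases m with
      | zero =>
        simp only [Nat.cast_zero, zero_mul]
        rw [utility_zero_left v k i hy (by linarith) hyv, coinPhi_neg_right (by omega) (by omega),
          coinPhi_neg_left (by omega) (by omega), coinPhi_neg_left (by omega) (by omega)]
        ring
      | succ m =>
        have h := ih m n (by omega)
          (two_pow_mul_lt_of_le hx.le (by push_cast; linarith) hvx)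
          (two_pow_mul_lt_of_le hy.le le_rfl hvy)
        push_cast
        rw [h, show (m : ℤ) + 1 - 1 = m by ring, show (m : ℤ) + 1 - 2 = m - 1 by ring]
        ring
    have hlose : utility v k i ((m + 1) * q) (n * q)
        = m * v i + coinPhi (n - 1) m * v i + coinPhi m (n - 1) * ((m + 1) * q)
          - coinPhi (m - 1) n * (n * q) := by
      cases n with
      | zero =>
        simp only [Nat.cast_zero, zero_mul]
        rw [utility_zero_right v k i hx hxv (by linarith), coinPhi_neg_left (by omega) (by omega),
          coinPhi_neg_right (by omega) (by omega)]
        obtain rfl : m = k := by omega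
        ring
      | succ n =>
        have h := ih m n (by omega) (two_pow_mul_lt_of_le hx.le le_rfl hvx)
          (two_pow_mul_lt_of_le hy.le (by push_cast; linarith) hvy)
        push_cast
        rw [h, show (n : ℤ) + 1 - 1 = n by ring]
    rw [(utilityShape v k).utility_jump i m n (by omega) hq hvx hvy, hwin, hlose,
      coinPhi_rec n m (by omega), coinPhi_rec m n (by omega), coinPhi_rec (m - 1) (n + 1) (by omega),
      show (m : ℤ) - 1 - 1 = m - 2 by ring, show (n : ℤ) + 1 - 1 = n by ring]
    ring

end SeqAuction

/-! ### Limits at the walls, and the proposition -/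

namespace SeqAuction

variable {v : Bool → ℝ}

theorem tendsto_utility {α : Type*} {l : Filter α} {f : α → ℝ × ℝ} (k : ℕ) (i : Bool) (m n : ℕ)
    {x y : ℝ} (hmn : m + n = k) (hx : 0 < x) (hy : 0 < y) (hvx : 2 ^ k * x < v i)
    (hvy : 2 ^ k * y < v (!i)) (hf : Tendsto f l (𝓝 (x, y)))
    (hlow : ∀ᶠ t in l, m * (f t).2 < (n + 1) * (f t).1)
    (hup : ∀ᶠ t in l, n * (f t).1 < (m + 1) * (f t).2) :
    Tendsto (fun t => utility v k i (f t).1 (f t).2) l (𝓝 (m * v i + leftover m n x y)) := by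
  have h1 : Tendsto (fun t => m * v i + leftover m n (f t).1 (f t).2) l
      (𝓝 (m * v i + leftover m n x y)) :=
    ((continuousAt_leftover m n hx.le).tendsto.comp hf).const_add _
  have hfx : Tendsto (fun t => (f t).1) l (𝓝 x) := (continuous_fst.tendsto (x, y)).comp hf
  have hfy : Tendsto (fun t => (f t).2) l (𝓝 y) := (continuous_snd.tendsto (x, y)).comp hf
  refine h1.congr' ?_
  filter_upwards [hlow, hup, hfx.eventually (lt_mem_nhds hx), hfy.eventually (lt_mem_nhds hy),
    (hfx.const_mul (2 ^ k)).eventually (gt_mem_nhds hvx),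
    (hfy.const_mul (2 ^ k)).eventually (gt_mem_nhds hvy)] with t h2 h3 h4 h5 h6 h7
  exact ((utilityShape v k).interior i m n _ _ hmn h4 h5 h6 h7 h2 h3).symm

theorem exists_interior_or_jump (k : ℕ) {x y : ℝ} (hx : 0 < x) (hy : 0 < y) :
    (∃ m n : ℕ, m + n = k ∧ m * y < (n + 1) * x ∧ n * x < (m + 1) * y) ∨
      ∃ m n : ℕ, m + n = k ∧ m * y = (n + 1) * x := by
  -- Start above the lower wall of cell $(0,k)$ and cross walls until one is hit or lies ahead.
  have key : ∀ n m : ℕ, m + n = k → m * y < (n + 1) * x →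
      (∃ m n : ℕ, m + n = k ∧ m * y < (n + 1) * x ∧ n * x < (m + 1) * y) ∨
        ∃ m n : ℕ, m + n = k ∧ m * y = (n + 1) * x := by
    intro n
    induction n with
    | zero => exact fun m hmn h => Or.inl ⟨m, 0, hmn, h, by rw [Nat.cast_zero, zero_mul]; positivity⟩
    | succ n ih =>
      intro m hmn h
      have hr := ih (m + 1) (by omega)
      push_cast at hr
      rcases lt_trichotomy ((m + 1) * y) ((n + 1) * x) with h1 | h1 | h1
      · exact hr h1
      · exact Or.inr ⟨m + 1, n, by omega, by push_cast; exact h1⟩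
      · exact Or.inl ⟨m, n + 1, hmn, h, by push_cast; exact h1⟩
  exact key k 0 (by omega) (by rw [Nat.cast_zero, zero_mul]; positivity)

theorem tendsto_utility_at_jump (k : ℕ) (i : Bool) (m n : ℕ) {x y : ℝ} (hmn : m + 1 + n = k)
    (hx : 0 < x) (hy : 0 < y) (hvx : 2 ^ k * x < v i) (hvy : 2 ^ k * y < v (!i))
    (h : (m + 1) * y = (n + 1) * x) :
    Tendsto (fun t => utility v k i x t) (𝓝[<] y) (𝓝 ((m + 1) * v i)) ∧
    Tendsto (fun t => utility v k i x t) (𝓝[>] y) (𝓝 (m * v i + x)) ∧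
    Tendsto (fun t => utility v k i t y) (𝓝[<] x) (𝓝 (m * v i + x)) ∧
    Tendsto (fun t => utility v k i t y) (𝓝[>] x) (𝓝 ((m + 1) * v i)) := by
  have hm1 : (0 : ℝ) < m + 1 := by positivity
  have hn1 : (0 : ℝ) < n + 1 := by positivity
  have hlo : ((m + 1 : ℕ) : ℝ) * v i + leftover (m + 1) n x y = (m + 1) * v i := by
    rw [leftover_lower (m + 1) n hx.le hy.le (by push_cast; exact h)]
    push_cast
    ring
  have hhi : (m : ℝ) * v i + leftover m (n + 1) x y = m * v i + x := by
    rw [leftover_upper m (n + 1) hx.le (by push_cast; exact h.symm)]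
  have hfx (s : Set ℝ) : Tendsto (fun t : ℝ => (t, y)) (𝓝[s] x) (𝓝 (x, y)) :=
    ((by fun_prop : Continuous fun t : ℝ => (t, y)).tendsto x).mono_left nhdsWithin_le_nhds
  have hfy (s : Set ℝ) : Tendsto (fun t : ℝ => (x, t)) (𝓝[s] y) (𝓝 (x, y)) :=
    ((by fun_prop : Continuous fun t : ℝ => (x, t)).tendsto y).mono_left nhdsWithin_le_nhds
  have hlin (a b : ℝ) : Continuous fun z : ℝ × ℝ => b * z.2 - a * z.1 := by fun_prop
  -- The point lies between cells $(m+1,n)$ and $(m,n+1)$; `hup` and `hdn` keep nearby points away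
  -- from their respective far walls.
  have hup : ∀ᶠ z : ℝ × ℝ in 𝓝 (x, y), 0 < ((m : ℝ) + 2) * z.2 - n * z.1 :=
    (hlin _ _).continuousAt.eventually (lt_mem_nhds (by simp only; linarith))
  have hdn : ∀ᶠ z : ℝ × ℝ in 𝓝 (x, y), m * z.2 - ((n : ℝ) + 2) * z.1 < 0 :=
    (hlin _ _).continuousAt.eventually (gt_mem_nhds (by simp only; linarith))
  refine ⟨?_, ?_, ?_, ?_⟩
  · rw [← hlo]
    refine tendsto_utility k i (m + 1) n hmn hx hy hvx hvy (hfy _) ?_ ?_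
    · filter_upwards [self_mem_nhdsWithin] with t (ht : t < y)
      push_cast
      exact (mul_lt_mul_of_pos_left ht hm1).trans_eq h
    · filter_upwards [(hfy _).eventually hup] with t ht
      push_cast
      linarith
  · rw [← hhi]
    refine tendsto_utility k i m (n + 1) (by omega) hx hy hvx hvy (hfy _) ?_ ?_
    · filter_upwards [(hfy _).eventually hdn] with t ht
      push_cast
      linarith
    · filter_upwards [self_mem_nhdsWithin] with t (ht : y < t)
      push_cast
      exact h.symm.trans_lt (mul_lt_mul_of_pos_left ht hm1)
  · rw [← hhi]
    refine tendsto_utility k i m (n + 1) (by omega) hx hy hvx hvy (hfx _) ?_ ?_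
    · filter_upwards [(hfx _).eventually hdn] with t ht
      push_cast
      linarith
    · filter_upwards [self_mem_nhdsWithin] with t (ht : t < x)
      push_cast
      exact (mul_lt_mul_of_pos_left ht hn1).trans_eq h.symm
  · rw [← hlo]
    refine tendsto_utility k i (m + 1) n hmn hx hy hvx hvy (hfx _) ?_ ?_
    · filter_upwards [self_mem_nhdsWithin] with t (ht : x < t)
      push_cast
      exact h.trans_lt (mul_lt_mul_of_pos_left ht hn1)
    · filter_upwards [(hfx _).eventually hup] with t ht
      push_cast
      linarith

end SeqAuction

theorem mainTheorem6 (v : Bool → ℝ) (k : ℕ) (i : Bool) (x y : ℝ) (hx : 0 < x) (hy : 0 < y)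
    (hvx : 2 ^ k * x < v i) (hvy : 2 ^ k * y < v (!i)) :
    (ContinuousAt (fun b : ℝ × ℝ => SeqAuction.utility v k i b.1 b.2) (x, y) ↔
      ∀ m n : ℕ, m + n = k → x / y ≠ (m : ℝ) / ((n : ℝ) + 1)) ∧
    (∀ m n : ℕ, m + n = k → x / y = (m : ℝ) / ((n : ℝ) + 1) →
      Tendsto (fun t => SeqAuction.utility v k i x t) (𝓝[<] (((n : ℝ) + 1) / (m : ℝ) * x))
        (𝓝 ((m : ℝ) * v i)) ∧
      Tendsto (fun t => SeqAuction.utility v k i x t) (𝓝[>] (((n : ℝ) + 1) / (m : ℝ) * x))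
        (𝓝 (((m : ℝ) - 1) * v i + x)) ∧
      Tendsto (fun t => SeqAuction.utility v k i t y) (𝓝[<] ((m : ℝ) / ((n : ℝ) + 1) * y))
        (𝓝 (((m : ℝ) - 1) * v i + (m : ℝ) / ((n : ℝ) + 1) * y)) ∧
      Tendsto (fun t => SeqAuction.utility v k i t y) (𝓝[>] ((m : ℝ) / ((n : ℝ) + 1) * y))
        (𝓝 ((m : ℝ) * v i)) ∧
      SeqAuction.utility v k i x y =
        ((m : ℝ) - 1) * v i + SeqAuction.coinPhi n ((m : ℤ) - 1) * v i
          + SeqAuction.coinPhi ((m : ℤ) - 1) n * x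
          - SeqAuction.coinPhi ((m : ℤ) - 2) ((n : ℤ) + 1) * y) := by
  have hjump : ∀ m n : ℕ, x / y = (m : ℝ) / ((n : ℝ) + 1) ↔ m * y = (n + 1) * x := by
    intro m n
    rw [div_eq_div_iff hy.ne' (by positivity), mul_comm x]
    exact eq_comm
  have hpos : ∀ m n : ℕ, m * y = (n + 1) * x → ∃ m', m = m' + 1 := by
    intro m n h
    refine Nat.exists_eq_succ_of_ne_zero ?_
    rintro rfl
    rw [Nat.cast_zero, zero_mul] at h
    exact (mul_pos n.cast_add_one_pos hx).ne h
  refine ⟨⟨fun hc m n hmn h => ?_, fun hno => ?_⟩, fun m n hmn h => ?_⟩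
  · rw [hjump] at h
    obtain ⟨m, rfl⟩ := hpos m n h
    push_cast at h
    obtain ⟨h1, h2, -, -⟩ := SeqAuction.tendsto_utility_at_jump k i m n hmn hx hy hvx hvy h
    have h3 : Tendsto (fun t => SeqAuction.utility v k i x t) (𝓝 y)
        (𝓝 (SeqAuction.utility v k i x y)) :=
      hc.tendsto.comp ((by fun_prop : Continuous fun t : ℝ => (x, t)).tendsto y)
    -- Continuity would identify the limits `(m + 1) * v i` and `m * v i + x`, although `x < v i`.
    have h4 := tendsto_nhds_unique h1 (h3.mono_left nhdsWithin_le_nhds)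
    have h5 := tendsto_nhds_unique h2 (h3.mono_left nhdsWithin_le_nhds)
    have h6 := SeqAuction.lt_of_two_pow_mul_lt hx.le hvx
    linarith
  · rcases SeqAuction.exists_interior_or_jump k hx hy with ⟨m, n, hmn, h1, h2⟩ | ⟨m, n, hmn, h1⟩
    · have h3 : ∀ᶠ z : ℝ × ℝ in 𝓝 (x, y), m * z.2 < (n + 1) * z.1 :=
        (by fun_prop : Continuous fun z : ℝ × ℝ => (m : ℝ) * z.2).continuousAt.eventually_lt
          (by fun_prop : Continuous fun z : ℝ × ℝ => ((n : ℝ) + 1) * z.1).continuousAt h1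
      have h4 : ∀ᶠ z : ℝ × ℝ in 𝓝 (x, y), n * z.1 < (m + 1) * z.2 :=
        (by fun_prop : Continuous fun z : ℝ × ℝ => (n : ℝ) * z.1).continuousAt.eventually_lt
          (by fun_prop : Continuous fun z : ℝ × ℝ => ((m : ℝ) + 1) * z.2).continuousAt h2
      have h5 := SeqAuction.tendsto_utility k i m n hmn hx hy hvx hvy tendsto_id h3 h4
      unfold ContinuousAt
      beta_reduce
      rwa [(SeqAuction.utilityShape v k).interior i m n x y hmn hx hy hvx hvy h1 h2]
    · exact absurd ((hjump m n).mpr h1) (hno m n hmn)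
  · rw [hjump] at h
    obtain ⟨m, rfl⟩ := hpos m n h
    have hm1 : (0 : ℝ) < m + 1 := by positivity
    have hn1 : (0 : ℝ) < n + 1 := by positivity
    push_cast at h ⊢
    have hy' : ((n : ℝ) + 1) / (m + 1) * x = y := by
      rw [div_mul_eq_mul_div, ← h, mul_div_cancel_left₀ _ hm1.ne']
    have hx' : ((m : ℝ) + 1) / (n + 1) * y = x := by
      rw [div_mul_eq_mul_div, h, mul_div_cancel_left₀ _ hn1.ne']
    rw [hx', hy', add_sub_cancel_right]
    obtain ⟨h1, h2, h3, h4⟩ := SeqAuction.tendsto_utility_at_jump k i m n hmn hx hy hvx hvy h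
    refine ⟨h1, h2, h3, h4, ?_⟩
    obtain ⟨q, rfl⟩ : ∃ q, x = (m + 1) * q := ⟨x / (m + 1), by field_simp⟩
    obtain rfl : y = (n + 1) * q := mul_left_cancel₀ hm1.ne' (by linarith)
    rw [SeqAuction.utility_at_jump k i m n hmn (pos_of_mul_pos_right hx hm1.le) hvx hvy,
      add_sub_cancel_right, show (m : ℤ) + 1 - 2 = m - 1 by ring]
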